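/- Throughout, ${}_2F_1(a,b;c;z)$ denotes the Gauss hypergeometric function on $\mathbb{C}\setminus[1,\infty)$, i.e. the analytic continuation of the Gauss series from the unit disc, $\mathbb{R}_+=(0,\infty)$, and all $L^2$ functions may be complex-valued. Let $\lambda>-\frac1\pi$ and $\mu>0$ be real. Put $$\alpha_\lambda=\frac{\arcsin(\lambda\pi)}{\pi}\ \text{ for } |\lambda|\le\tfrac1\pi,\qquad \alpha_\lambda=\frac12+\mathrm{i}\,\frac{\operatorname{arcosh}(\lambda\pi)}{\pi}\ \text{ for } \lambda\ge\tfrac1\pi,$$ $$c_\lambda=\frac{\lambda}{\alpha_\lambda(1-\alpha_\lambda)}\ \text{ for }\lambda\ne0,\qquad c_0=1,$$ and, for $x\ge 0$, $$J(x)=x\;{}_2F_1\Big(\alpha_\lambda,1-\alpha_\lambda;2;-\frac{x}{\mu^2}\Big),\qquad \phi(x)={}_2F_1(1+\alpha_\lambda,2-\alpha_\lambda;2;-x).$$ Then: 1. $\sin(\alpha_\lambda\pi)=\lambda\pi$, the number $c_\lambda$ is real, and $J$ and $\phi$ are real-valued on $[0,\infty)$. 2. For every $x\ge0$ the following integral converges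 absolutely and $$J(x)=x-\lambda x^2\int_0^\infty \frac{J(t)}{(t+\mu^2)^2(t+\mu^2+x)}\,dt. \tag{Fred}$$ 3. Equivalently, after the rescaling $J(x)=x\big(1+\frac{x}{\mu^2}\big)\,\phi\big(\frac{x}{\mu^2}\big)$ ($x\ge0$), $\phi$ satisfies, for every $x\ge0$ and with an absolutely convergent integral, $$\phi(x)=\frac{c_\lambda}{1+x}-\lambda\int_0^\infty\frac{\phi(t)}{1+t+x}\,dt,\qquad \phi(0)=1. \tag{feq}$$ 4. The solutions are unique in $L^2(\mathbb{R}_+)$, in the following sense. The functions $\frac{J(x)}{x(\mu^2+x)}$ and $\phi$ belong to $L^2(\mathbb{R}_+)$. If $K$ is a function such that $\frac{K(x)}{x(\mu^2+x)}$ lies in $L^2(\mathbb{R}_+)$ and $K$ satisfies (Fred) for almost every $x>0$, then $K=J$ almost everywhere on $\mathbb{R}_+$. If $\psi\in L^2(\mathbb{R}_+)$ satisfies the integral equation in (feq), with the constant $c_\lambda$, for almost every $x>0$, then $\psi=\phi$ almost everywhere on $\mathbb{R}_+$. Finally, if $c\in\mathbb{C}$ and $\psi:[0,\infty)\to\mathbb{C}$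 is square-integrable on $\mathbb{R}_+$, has $\psi(0)=1$, and satisfies $\psi(x)=\frac{c}{1+x}-\lambda\int_0^\infty\frac{\psi(t)}{1+t+x}\,dt$ for every $x\ge0$ with absolutely convergent integrals, then $c=c_\lambda$ and $\psi=\phi$ on $[0,\infty)$. -/

import Mathlib

open MeasureTheory

noncomputable section

namespace SelfDualPhi4

/-- The plane cut along `[1, ∞)`. -/
def cutPlane : Set ℂ := {z | 1 - z ∈ Complex.slitPlane}

/-- `F` is holomorphic on `ℂ ∖ [1, ∞)` and is given on the open unit disc by the Gauss series
`∑ (a)_n (b)_n / ((c)_n n!) z ^ n`. -/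
def IsGaussContinuation (a b c : ℂ) (F : ℂ → ℂ) : Prop :=
  DifferentiableOn ℂ F cutPlane ∧ ∀ z ∈ Metric.ball (0 : ℂ) 1, F z = ordinaryHypergeometric a b c z

open Classical in
/-- The Gauss hypergeometric function `₂F₁(a, b; c; z)` on `ℂ ∖ [1, ∞)` (principal branch), i.e. the
analytic continuation of the Gauss series. The series alone is not enough, as Mathlib's
`ordinaryHypergeometric` carries no information outside the disc of convergence. -/
def hyp2F1 (a b c : ℂ) : ℂ → ℂ :=
  if h : ∃ F : ℂ → ℂ, IsGaussContinuation a b c F then h.choose else 0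

theorem isOpen_cutPlane : IsOpen cutPlane :=
  Complex.isOpen_slitPlane.preimage (continuous_const.sub continuous_id)

theorem zero_mem_cutPlane : (0 : ℂ) ∈ cutPlane := by
  simp [cutPlane]

theorem isPreconnected_cutPlane : IsPreconnected cutPlane := by
  have h : cutPlane = (fun w : ℂ => 1 - w) '' Complex.slitPlane := by
    ext z
    constructor
    · intro hz
      exact ⟨1 - z, hz, by simp⟩
    · rintro ⟨w, hw, rfl⟩
      simpa [cutPlane] using hw
  rw [h]
  have hs : IsPreconnected Complex.slitPlane :=
    (Complex.starConvex_one_slitPlane.isPathConnected Complex.one_mem_slitPlane).isConnected.isPreconnected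
  exact hs.image _ (continuous_const.sub continuous_id).continuousOn

/-- The continuation is unique, so `hyp2F1` does not depend on the choice made in its definition. -/
theorem IsGaussContinuation.eqOn_hyp2F1 {a b c : ℂ} {F : ℂ → ℂ} (hF : IsGaussContinuation a b c F) :
    Set.EqOn F (hyp2F1 a b c) cutPlane := by
  have h : ∃ F : ℂ → ℂ, IsGaussContinuation a b c F := ⟨F, hF⟩
  have hG : IsGaussContinuation a b c (hyp2F1 a b c) := by
    rw [hyp2F1, dif_pos h]
    exact h.choose_spec
  refine AnalyticOnNhd.eqOn_of_preconnected_of_eventuallyEq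
    (hF.1.analyticOnNhd isOpen_cutPlane) (hG.1.analyticOnNhd isOpen_cutPlane)
    isPreconnected_cutPlane zero_mem_cutPlane ?_
  filter_upwards [Metric.ball_mem_nhds (0 : ℂ) one_pos] with z hz
  rw [hF.2 z hz, hG.2 z hz]

/-- `α_λ = arcsin(λπ)/π` for `|λ| ≤ 1/π` and `α_λ = 1/2 + i arcosh(λπ)/π` for `λ ≥ 1/π`; the two
expressions agree at `λ = 1/π`. -/
def alphaParam (lam : ℝ) : ℂ :=
  if lam ≤ 1 / Real.pi then ((Real.arcsin (lam * Real.pi) / Real.pi : ℝ) : ℂ)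
  else 1 / 2 + Complex.I * ((Real.arcosh (lam * Real.pi) / Real.pi : ℝ) : ℂ)

theorem alphaParam_of_ge {lam : ℝ} (h : 1 / Real.pi ≤ lam) :
    alphaParam lam = 1 / 2 + Complex.I * ((Real.arcosh (lam * Real.pi) / Real.pi : ℝ) : ℂ) := by
  rcases h.eq_or_lt with rfl | h
  · have h1 : (1 / Real.pi) * Real.pi = 1 := by field_simp
    have h2 : Real.pi / 2 / Real.pi = 1 / 2 := by field_simp
    simp [alphaParam, h2]
  · rw [alphaParam, if_neg (not_le.mpr h)]

/-- `c_λ = λ/(α_λ(1 - α_λ))`, continued by its limit `1` to `λ = 0`, where `α_λ = 0`. -/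
def cParam (lam : ℝ) : ℂ :=
  if lam = 0 then 1 else (lam : ℂ) / (alphaParam lam * (1 - alphaParam lam))

/-- `J(x) = x ₂F₁(α_λ, 1 - α_λ; 2; -x/μ²)`. -/
def solJ (lam mu : ℝ) (x : ℝ) : ℂ :=
  (x : ℂ) * hyp2F1 (alphaParam lam) (1 - alphaParam lam) 2 ((-(x / mu ^ 2) : ℝ) : ℂ)

/-- `φ(x) = ₂F₁(1 + α_λ, 2 - α_λ; 2; -x)`. -/
def solPhi (lam : ℝ) (x : ℝ) : ℂ :=
  hyp2F1 (1 + alphaParam lam) (2 - alphaParam lam) 2 ((-x : ℝ) : ℂ)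

/-- Lebesgue measure on `ℝ₊ = (0, ∞)`. -/
def volPos : Measure ℝ := volume.restrict (Set.Ioi 0)

/-- The integrand of the Fredholm equation for `J`. -/
def fredIntegrand (mu : ℝ) (J : ℝ → ℂ) (x t : ℝ) : ℂ :=
  J t / (((t + mu ^ 2) ^ 2 * (t + mu ^ 2 + x) : ℝ) : ℂ)

/-- The right-hand side `x - λ x² ∫₀^∞ J(t) / ((t + μ²)² (t + μ² + x)) dt`. -/
def fredRHS (lam mu : ℝ) (J : ℝ → ℂ) (x : ℝ) : ℂ :=
  (x : ℂ) - (lam : ℂ) * (x : ℂ) ^ 2 * ∫ t, fredIntegrand mu J x t ∂volPos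

/-- The integrand of the rescaled equation for `φ`. -/
def rescaledIntegrand (phi : ℝ → ℂ) (x t : ℝ) : ℂ :=
  phi t / ((1 + t + x : ℝ) : ℂ)

/-- The right-hand side `c / (1 + x) - λ ∫₀^∞ φ(t) / (1 + t + x) dt`. -/
def rescaledRHS (lam : ℝ) (c : ℂ) (phi : ℝ → ℂ) (x : ℝ) : ℂ :=
  c / ((1 + x : ℝ) : ℂ) - (lam : ℂ) * ∫ t, rescaledIntegrand phi x t ∂volPos

/-- `J` solves the Fredholm equation at every `x ≥ 0`, with absolutely convergent integrals. -/
def SolvesFredholm (lam mu : ℝ) (J : ℝ → ℂ) : Prop :=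
  ∀ x : ℝ, 0 ≤ x → Integrable (fredIntegrand mu J x) volPos ∧ J x = fredRHS lam mu J x

/-- `φ` solves the rescaled equation with constant `c` at every `x ≥ 0`, with absolutely convergent
integrals, and is normalised by `φ(0) = 1`. -/
def SolvesRescaled (lam : ℝ) (c : ℂ) (phi : ℝ → ℂ) : Prop :=
  (∀ x : ℝ, 0 ≤ x → Integrable (rescaledIntegrand phi x) volPos ∧ phi x = rescaledRHS lam c phi x) ∧
    phi 0 = 1

/-- The rescaling `ρ(x) = J(x) / (x (μ² + x))`, which is the unknown for which the equation is posed
in `L²(ℝ₊)`. -/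
def symmetrised (mu : ℝ) (J : ℝ → ℂ) (x : ℝ) : ℂ :=
  J x / ((x * (mu ^ 2 + x) : ℝ) : ℂ)

end SelfDualPhi4

end

noncomputable section

namespace SelfDualPhi4

/-! Existence. Write `a n` for the Taylor coefficients of `φ(-z) = ₂F₁(1 + α, 2 - α; 2; z)`, and `m
n` for the moments `∫ φ(t) (1 + t)^(-n-1) dt`. The Gauss recursion is `(n+1)(n+2) a (n+1) =
((n+1)(n+2) + α(1-α)) a n`. The differential equation `(x(1+x)φ)'' = -α(1-α)φ` and two integrations
by parts show that the moments obey the same recursion with an extra `-1` on the right. Since `λ = c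
α(1-α)`, the defect `a n + λ m n - c` is again a solution of the homogeneous first-order recursion,
hence a multiple of `a n`. By Euler's sine product `a n` tends to `sin(πα)/(π α(1-α)) = c ≠ 0`,
while `m n` tends to `0`; so the defect tends to `0` and the multiple is zero. The resulting
identities `a n + λ m n = c` (`phiCoeff_add_phiMoment`) are the Taylor coefficients of `φ(z) + λ ∫
φ(t)/(1+t+z) dt = c/(1+z)` on the unit disc, and the identity theorem carries the equation to `Re z
> -1` (`gaussPhi_add_phiStieltjes`). The Fredholm equation for `J` follows by Euler's
transformation, a partial fraction and the value of the equation for `φ` at `0`.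

Analytic input. Euler's integral provides the continuation of the series, and the bound `φ(x) =
O((1+x)^(-s))` for some `s > 1/2`. Such an `s` exists because `λ > -1/π` forces `Re α > -1/2`; it
gives membership in `L²`.

Uniqueness. After symmetrisation both equations have a kernel `w(x) w(t)/(m+x+t)` with `0 ≤ w ≤ 1`.
This kernel is positive, by Laplace transform, and bounded by `π`, by Hilbert's inequality, so
`-1/λ` cannot be an eigenvalue when `λ > -1/π` (`eq_zero_of_homogeneous`). Reality of `φ` and the
determination of `c` are consequences of uniqueness. -/

/-! ### Euler's integral and the continuation of the Gauss series -/

/-- The weight `u ^ (b - 1) (1 - u) ^ (c - 1)` of the Beta integral. -/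
def betaWeight (b c : ℂ) (u : ℝ) : ℂ :=
  (u : ℂ) ^ (b - 1) * (1 - (u : ℂ)) ^ (c - 1)

/-- Euler's integral for `₂F₁(a, b; c; z)`. -/
def eulerIntegral (a b c z : ℂ) : ℂ :=
  (Complex.betaIntegral b (c - b))⁻¹ *
    ∫ u in (0 : ℝ)..1, betaWeight b (c - b) u * (1 - z * u) ^ (-a)

theorem intervalIntegrable_betaWeight {b c : ℂ} (hb : 0 < b.re) (hc : 0 < c.re) :
    IntervalIntegrable (betaWeight b c) volume 0 1 :=
  Complex.betaIntegral_convergent hb hc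

/-- The slit plane is star-shaped about `1`, and `1 - z u` lies on the segment from `1` to `1 - z`.
This keeps the principal branch in Euler's integral holomorphic in `z`. -/
theorem one_sub_mul_mem_slitPlane {z : ℂ} (hz : z ∈ cutPlane) {u : ℝ} (hu : u ∈ Set.Icc (0 : ℝ) 1) :
    1 - z * u ∈ Complex.slitPlane := by
  have h := Complex.starConvex_one_slitPlane hz (a := 1 - u) (b := u)
    (by linarith [hu.2]) hu.1 (by ring)
  convert h using 1
  simp only [Complex.real_smul]
  push_cast
  ring

theorem continuousOn_one_sub_mul_cpow (s : ℂ) :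
    ContinuousOn (fun p : ℂ × ℝ => (1 - p.1 * (p.2 : ℂ)) ^ s) (cutPlane ×ˢ Set.Icc (0 : ℝ) 1) := by
  refine ContinuousOn.cpow_const (by fun_prop) ?_
  rintro ⟨z, u⟩ ⟨hz, hu⟩
  exact one_sub_mul_mem_slitPlane hz hu

theorem continuousOn_one_sub_mul_cpow_right (s : ℂ) {z : ℂ} (hz : z ∈ cutPlane) :
    ContinuousOn (fun u : ℝ => (1 - z * (u : ℂ)) ^ s) (Set.Icc (0 : ℝ) 1) :=
  (continuousOn_one_sub_mul_cpow s).comp (f := fun u : ℝ => (z, u)) (by fun_prop)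
    fun _ hu => ⟨hz, hu⟩

theorem integrableOn_betaWeight_mul {b c : ℂ} (hb : 0 < b.re) (hc : 0 < c.re) (s : ℂ) {z : ℂ}
    (hz : z ∈ cutPlane) :
    IntegrableOn (fun u : ℝ => betaWeight b c u * (1 - z * (u : ℂ)) ^ s) (Set.Icc 0 1) := by
  have hw : IntegrableOn (betaWeight b c) (Set.Icc 0 1) :=
    (intervalIntegrable_iff_integrableOn_Icc_of_le zero_le_one).mp
      (intervalIntegrable_betaWeight hb hc)
  exact hw.mul_continuousOn (continuousOn_one_sub_mul_cpow_right s hz) isCompact_Icc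

theorem differentiableOn_eulerIntegral {a b c : ℂ} (hb : 0 < b.re) (hcb : 0 < (c - b).re) :
    DifferentiableOn ℂ (eulerIntegral a b c) cutPlane := by
  intro z₀ hz₀
  refine DifferentiableAt.differentiableWithinAt ?_
  obtain ⟨ε, hε, hball⟩ := Metric.nhds_basis_closedBall.mem_iff.mp (isOpen_cutPlane.mem_nhds hz₀)
  have hK : IsCompact (Metric.closedBall z₀ ε ×ˢ Set.Icc (0 : ℝ) 1) :=
    (isCompact_closedBall z₀ ε).prod isCompact_Icc
  obtain ⟨C, hC⟩ := hK.exists_bound_of_continuousOn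
    ((continuousOn_one_sub_mul_cpow (-a - 1)).mono (Set.prod_mono hball le_rfl))
  have hw : IntegrableOn (betaWeight b (c - b)) (Set.Icc 0 1) :=
    (intervalIntegrable_iff_integrableOn_Icc_of_le zero_le_one).mp
      (intervalIntegrable_betaWeight hb hcb)
  have key := hasDerivAt_integral_of_dominated_loc_of_deriv_le
    (μ := volume.restrict (Set.Icc (0 : ℝ) 1)) (x₀ := z₀) (s := Metric.closedBall z₀ ε)
    (F := fun z u => betaWeight b (c - b) u * (1 - z * (u : ℂ)) ^ (-a))
    (F' := fun z u => betaWeight b (c - b) u * (a * u * (1 - z * (u : ℂ)) ^ (-a - 1)))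
    (bound := fun u => ‖betaWeight b (c - b) u‖ * (‖a‖ * C))
    (Metric.closedBall_mem_nhds z₀ hε) ?_ ?_ ?_ ?_ ?_ ?_
  · have h2 : eulerIntegral a b c = fun z => (Complex.betaIntegral b (c - b))⁻¹ *
        ∫ u in Set.Icc (0 : ℝ) 1, betaWeight b (c - b) u * (1 - z * (u : ℂ)) ^ (-a) := by
      ext z
      rw [eulerIntegral, intervalIntegral.integral_of_le zero_le_one, integral_Icc_eq_integral_Ioc]
    rw [h2]
    exact key.2.differentiableAt.const_mul _
  · filter_upwards [isOpen_cutPlane.mem_nhds hz₀] with z hz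
    exact (integrableOn_betaWeight_mul hb hcb _ hz).aestronglyMeasurable
  · exact integrableOn_betaWeight_mul hb hcb _ hz₀
  · refine hw.aestronglyMeasurable.mul (ContinuousOn.aestronglyMeasurable ?_ measurableSet_Icc)
    exact ContinuousOn.mul (by fun_prop) (continuousOn_one_sub_mul_cpow_right _ hz₀)
  · refine (ae_restrict_mem measurableSet_Icc).mono fun u hu z hz => ?_
    have h1 := hC (z, u) ⟨hz, hu⟩
    rw [norm_mul, norm_mul, norm_mul, Complex.norm_real, Real.norm_of_nonneg hu.1]
    refine mul_le_mul_of_nonneg_left ?_ (norm_nonneg _)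
    refine mul_le_mul ?_ h1 (norm_nonneg _) (norm_nonneg _)
    exact mul_le_of_le_one_right (norm_nonneg _) hu.2
  · exact hw.norm.mul_const _
  · refine (ae_restrict_mem measurableSet_Icc).mono fun u hu z hz => ?_
    have h1 : HasDerivAt (fun z : ℂ => 1 - z * (u : ℂ)) (-(u : ℂ)) z := by
      simpa using ((hasDerivAt_id z).mul_const (u : ℂ)).const_sub 1
    have h2 := (h1.cpow_const (c := -a)
      (one_sub_mul_mem_slitPlane (hball hz) hu)).const_mul (betaWeight b (c - b) u)
    refine h2.congr_deriv ?_
    ring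

theorem ball_subset_cutPlane : Metric.ball (0 : ℂ) 1 ⊆ cutPlane := by
  intro z hz
  have := Complex.mem_slitPlane_of_norm_lt_one (z := -z) (by simpa using hz)
  simpa [cutPlane, sub_eq_add_neg] using this

theorem choose_eq_ascPochhammer_div (a : ℂ) (n : ℕ) :
    Ring.choose (a + n - 1) n = ((n.factorial : ℂ))⁻¹ * (ascPochhammer ℂ n).eval a := by
  have h := Ring.factorial_nsmul_multichoose_eq_ascPochhammer a n
  rw [Ring.multichoose_eq, nsmul_eq_mul, Polynomial.ascPochhammer_smeval_eq_eval] at h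
  rw [← h, inv_mul_cancel_left₀ (by exact_mod_cast n.factorial_ne_zero)]

theorem summable_norm_choose_mul_pow (a : ℂ) {r : ℝ} (hr0 : 0 ≤ r) (hr : r < 1) :
    Summable fun n : ℕ => ‖Ring.choose (a + n - 1) n‖ * r ^ n := by
  lift r to NNReal using hr0
  have h := (Complex.one_div_one_sub_cpow_hasFPowerSeriesOnBall_zero a).r_le
  have h2 := FormalMultilinearSeries.summable_norm_mul_pow
    (.ofScalars ℂ fun n ↦ Ring.choose (a + n - 1) n) (r := r)
    (lt_of_lt_of_le (by exact_mod_cast hr) h)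
  simpa using h2

theorem hasSum_one_sub_cpow (a : ℂ) {z : ℂ} (hz : ‖z‖ < 1) :
    HasSum (fun n : ℕ => Ring.choose (a + n - 1) n * z ^ n) ((1 - z) ^ (-a)) := by
  have h := (Complex.one_div_one_sub_cpow_hasFPowerSeriesOnBall_zero a).hasSum (y := z)
    (by simpa [enorm_eq_nnnorm, ← NNReal.coe_lt_one] using hz)
  simpa [Complex.cpow_neg, mul_comm] using h

/-- Both Beta integrals are quotients of Gamma values, and `Γ(s + n)/Γ(s)` is the rising factorial
of `s`. This produces the Pochhammer ratio when Euler's integral is expanded termwise. -/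
theorem betaIntegral_add_nat {b c : ℂ} (hb : 0 < b.re) (hc : 0 < c.re) (n : ℕ) :
    Complex.betaIntegral (b + n) c = Complex.betaIntegral b c *
      ((ascPochhammer ℂ n).eval b * ((ascPochhammer ℂ n).eval (b + c))⁻¹) := by
  have hbn : 0 < (b + n).re := by
    rw [Complex.add_re, Complex.natCast_re]; positivity
  have hne : ∀ {s : ℂ}, 0 < s.re → ∀ k : ℕ, s ≠ -k := by
    rintro s hs k rfl
    simp only [Complex.neg_re, Complex.natCast_re, Left.neg_pos_iff] at hs
    exact absurd hs (not_lt.mpr k.cast_nonneg)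
  have hbc : 0 < (b + c).re := by rw [Complex.add_re]; positivity
  have h1 := Complex.Gamma_mul_Gamma_eq_betaIntegral hb hc
  have h2 := Complex.Gamma_mul_Gamma_eq_betaIntegral hbn hc
  rw [← Complex.Gamma_add_nat_div_Gamma_eq b (hne hb),
    ← Complex.Gamma_add_nat_div_Gamma_eq (b + c) (hne hbc)]
  have g1 := Complex.Gamma_ne_zero_of_re_pos hb
  have g2 := Complex.Gamma_ne_zero_of_re_pos hbc
  have hbcn : 0 < (b + c + n).re := by
    rw [Complex.add_re, Complex.natCast_re]; positivity
  have g3 := Complex.Gamma_ne_zero_of_re_pos hbcn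
  rw [show b + n + c = b + c + n by ring] at h2
  field_simp
  linear_combination (-Complex.Gamma b) * h2 + Complex.Gamma (b + n) * h1

theorem integral_betaWeight_mul_pow (b c : ℂ) (n : ℕ) :
    ∫ u in (0 : ℝ)..1, betaWeight b c u * (u : ℂ) ^ n = Complex.betaIntegral (b + n) c := by
  rw [Complex.betaIntegral]
  refine intervalIntegral.integral_congr_ae (Filter.Eventually.of_forall fun u hu => ?_)
  rw [Set.uIoc_of_le zero_le_one] at hu
  have hu0 : (u : ℂ) ≠ 0 := by exact_mod_cast hu.1.ne'
  rw [betaWeight, show b + n - 1 = b - 1 + n by ring, Complex.cpow_add _ _ hu0,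
    Complex.cpow_natCast]
  ring

theorem betaIntegral_ne_zero {b c : ℂ} (hb : 0 < b.re) (hc : 0 < c.re) :
    Complex.betaIntegral b c ≠ 0 := by
  intro h
  have h1 := Complex.Gamma_mul_Gamma_eq_betaIntegral hb hc
  rw [h, mul_zero] at h1
  exact mul_ne_zero (Complex.Gamma_ne_zero_of_re_pos hb) (Complex.Gamma_ne_zero_of_re_pos hc) h1

/-- The factor `(1 - z u)^(-a)` is expanded in its binomial series, which converges uniformly in `u
∈ [0, 1]` for `‖z‖ < 1`, and integrated term by term against the Beta weight. -/
theorem hasSum_eulerIntegral {a b c : ℂ} (hb : 0 < b.re) (hcb : 0 < (c - b).re) {z : ℂ}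
    (hz : ‖z‖ < 1) :
    HasSum (fun n : ℕ => ordinaryHypergeometricCoefficient a b c n * z ^ n)
      (eulerIntegral a b c z) := by
  have hw : IntegrableOn (betaWeight b (c - b)) (Set.Ioc 0 1) :=
    (intervalIntegrable_iff_integrableOn_Ioc_of_le zero_le_one).mp
      (intervalIntegrable_betaWeight hb hcb)
  have key := hasSum_integral_of_dominated_convergence
    (μ := volume.restrict (Set.Ioc (0 : ℝ) 1))
    (F := fun (n : ℕ) u => betaWeight b (c - b) u *
      (Ring.choose (a + n - 1) n * (z * (u : ℂ)) ^ n))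
    (f := fun u => betaWeight b (c - b) u * (1 - z * (u : ℂ)) ^ (-a))
    (fun n u => ‖betaWeight b (c - b) u‖ * (‖Ring.choose (a + n - 1) n‖ * ‖z‖ ^ n))
    ?_ ?_ ?_ ?_ ?_
  · rw [eulerIntegral, intervalIntegral.integral_of_le zero_le_one]
    refine (key.mul_left (Complex.betaIntegral b (c - b))⁻¹).congr_fun ?_
    intro n
    have h1 : ∀ u : ℝ, betaWeight b (c - b) u * (Ring.choose (a + n - 1) n * (z * (u : ℂ)) ^ n) =
        (Ring.choose (a + n - 1) n * z ^ n) * (betaWeight b (c - b) u * (u : ℂ) ^ n) := by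
      intro u; ring
    simp_rw [h1]
    rw [integral_const_mul, ← intervalIntegral.integral_of_le zero_le_one,
      integral_betaWeight_mul_pow, betaIntegral_add_nat hb hcb, choose_eq_ascPochhammer_div,
      add_sub_cancel]
    have := betaIntegral_ne_zero hb hcb
    simp only [ordinaryHypergeometricCoefficient]
    field_simp
  · intro n
    exact hw.aestronglyMeasurable.mul (Continuous.aestronglyMeasurable (by fun_prop))
  · intro n
    refine (ae_restrict_mem measurableSet_Ioc).mono fun u hu => ?_
    rw [norm_mul, norm_mul, norm_pow, norm_mul, Complex.norm_real, Real.norm_of_nonneg hu.1.le]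
    have := mul_le_of_le_one_right (norm_nonneg z) hu.2
    have h0 := mul_nonneg (norm_nonneg z) hu.1.le
    gcongr
  · exact Filter.Eventually.of_forall fun u =>
      (summable_norm_choose_mul_pow a (norm_nonneg z) hz).mul_left _
  · simp_rw [tsum_mul_left]
    exact hw.norm.mul_const _
  · refine (ae_restrict_mem measurableSet_Ioc).mono fun u hu => ?_
    refine (hasSum_one_sub_cpow a ?_).mul_left _
    rw [norm_mul, Complex.norm_real, Real.norm_of_nonneg hu.1.le]
    exact (mul_le_of_le_one_right (norm_nonneg z) hu.2).trans_lt hz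

theorem isGaussContinuation_eulerIntegral {a b c : ℂ} (hb : 0 < b.re) (hcb : 0 < (c - b).re) :
    IsGaussContinuation a b c (eulerIntegral a b c) := by
  refine ⟨differentiableOn_eulerIntegral hb hcb, fun z hz => ?_⟩
  rw [ordinaryHypergeometric_eq_tsum]
  exact (hasSum_eulerIntegral hb hcb (by simpa using hz)).tsum_eq.symm

/-! ### The coefficients of the two Gauss series -/

/-- The Taylor coefficients of `₂F₁(1 + α, 2 - α; 2; z)`. -/
def phiCoeff (al : ℂ) (n : ℕ) : ℂ :=
  ordinaryHypergeometricCoefficient (1 + al) (2 - al) 2 n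

theorem phiCoeff_zero (al : ℂ) : phiCoeff al 0 = 1 := by
  simp [phiCoeff, ordinaryHypergeometricCoefficient]

theorem ordinaryHypergeometricCoefficient_two_succ (a b : ℂ) (n : ℕ) :
    ((n : ℂ) + 1) * (n + 2) * ordinaryHypergeometricCoefficient a b 2 (n + 1) =
      (a + n) * (b + n) * ordinaryHypergeometricCoefficient a b 2 n := by
  have h1 : (n.factorial : ℂ) ≠ 0 := by exact_mod_cast n.factorial_ne_zero
  have h2 : (n : ℂ) + 1 ≠ 0 := by exact_mod_cast n.succ_ne_zero
  have h3 : (2 : ℂ) + n ≠ 0 := by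
    rw [add_comm]; exact_mod_cast (Nat.succ_ne_zero (n + 1))
  simp only [ordinaryHypergeometricCoefficient, ascPochhammer_succ_eval, Nat.factorial_succ,
    mul_inv]
  push_cast
  field_simp
  ring

theorem phiCoeff_succ (al : ℂ) (n : ℕ) :
    ((n : ℂ) + 1) * (n + 2) * phiCoeff al (n + 1) =
      ((n + 1) * (n + 2) + al * (1 - al)) * phiCoeff al n := by
  rw [phiCoeff, ordinaryHypergeometricCoefficient_two_succ, phiCoeff]
  ring

/-- Coefficientwise, this is the hypergeometric equation `(z(1-z)F)'' = α(1-α)F`, once `(1-z)F` is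
identified with `₂F₁(α, 1-α; 2; z)`. -/
theorem succ_mul_ordinaryHypergeometricCoefficient (al : ℂ) (n : ℕ) :
    ((n : ℂ) + 1) * (n + 2) * ordinaryHypergeometricCoefficient al (1 - al) 2 (n + 1) =
      al * (1 - al) * phiCoeff al n := by
  induction n with
  | zero =>
    rw [ordinaryHypergeometricCoefficient_two_succ]
    simp [phiCoeff, ordinaryHypergeometricCoefficient]
  | succ n ih =>
    have h2 : (n : ℂ) + 1 ≠ 0 := by exact_mod_cast n.succ_ne_zero
    have h3 : (n : ℂ) + 2 ≠ 0 := by exact_mod_cast (Nat.succ_ne_zero (n + 1))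
    rw [ordinaryHypergeometricCoefficient_two_succ]
    refine mul_left_cancel₀ (mul_ne_zero h2 h3) ?_
    have h4 := phiCoeff_succ al n
    push_cast
    linear_combination ((al + (n + 1)) * (1 - al + (n + 1))) * ih - al * (1 - al) * h4

/-- Coefficientwise, this is Euler's transformation `₂F₁(α, 1-α; 2; z) = (1-z) ₂F₁(1+α, 2-α; 2; z)`.
-/
theorem ordinaryHypergeometricCoefficient_succ_eq_sub (al : ℂ) (n : ℕ) :
    ordinaryHypergeometricCoefficient al (1 - al) 2 (n + 1) =
      phiCoeff al (n + 1) - phiCoeff al n := by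
  have h2 : (n : ℂ) + 1 ≠ 0 := by exact_mod_cast n.succ_ne_zero
  have h3 : (n : ℂ) + 2 ≠ 0 := by exact_mod_cast (Nat.succ_ne_zero (n + 1))
  refine mul_left_cancel₀ (mul_ne_zero h2 h3) ?_
  linear_combination succ_mul_ordinaryHypergeometricCoefficient al n - phiCoeff_succ al n

/-- The ratio of consecutive coefficients is `(1 + α/(j+1))(1 - α/(j+2))`. Shifting the second
factor by one index gives a partial product of Euler's formula for the sine, up to an end correction
that tends to `1/(1-α)`. -/
theorem phiCoeff_eq_prod {al : ℂ} (h1 : al ≠ 1) (n : ℕ) :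
    phiCoeff al n = (∏ j ∈ Finset.range n, (1 - al ^ 2 / ((j : ℂ) + 1) ^ 2)) *
      ((n + 1 - al) / ((1 - al) * (n + 1))) := by
  have h1' : 1 - al ≠ 0 := sub_ne_zero.mpr h1.symm
  induction n with
  | zero => simp [phiCoeff_zero, h1']
  | succ n ih =>
    have h2 : (n : ℂ) + 1 ≠ 0 := by exact_mod_cast n.succ_ne_zero
    have h3 : (n : ℂ) + 2 ≠ 0 := by exact_mod_cast (Nat.succ_ne_zero (n + 1))
    have h3' : (n : ℂ) + 1 + 1 ≠ 0 := by rw [add_assoc, one_add_one_eq_two]; exact h3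
    refine mul_left_cancel₀ (mul_ne_zero h2 h3) ?_
    rw [phiCoeff_succ, ih, Finset.prod_range_succ]
    push_cast
    field_simp
    ring

theorem tendsto_phiCoeff {al : ℂ} (h0 : al ≠ 0) (h1 : al ≠ 1) :
    Filter.Tendsto (phiCoeff al) Filter.atTop
      (nhds (Complex.sin (al * Real.pi) / Real.pi / (al * (1 - al)))) := by
  have h1' : 1 - al ≠ 0 := sub_ne_zero.mpr h1.symm
  have hpi : (Real.pi : ℂ) ≠ 0 := by exact_mod_cast Real.pi_ne_zero
  have hprod := (Complex.tendsto_euler_sin_prod al).const_mul ((Real.pi : ℂ) * al)⁻¹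
  have hfrac : Filter.Tendsto (fun n : ℕ => (1 - al * (1 / ((n : ℂ) + 1))) * (1 - al)⁻¹)
      Filter.atTop (nhds ((1 - al * 0) * (1 - al)⁻¹)) :=
    ((tendsto_one_div_add_atTop_nhds_zero_nat (𝕜 := ℂ)).const_mul al).const_sub 1 |>.mul_const _
  have h := hprod.mul hfrac
  have hlim : ((Real.pi : ℂ) * al)⁻¹ * Complex.sin (Real.pi * al) * ((1 - al * 0) * (1 - al)⁻¹) =
      Complex.sin (al * Real.pi) / Real.pi / (al * (1 - al)) := by
    rw [mul_comm al (Real.pi : ℂ)]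
    field_simp
    ring
  rw [hlim] at h
  refine h.congr fun n => ?_
  have h2 : (n : ℂ) + 1 ≠ 0 := by exact_mod_cast n.succ_ne_zero
  rw [phiCoeff_eq_prod h1]
  field_simp

/-! ### Taylor coefficients on the unit disc -/

/-- Uniqueness of power series, used to compare the given expansion with the Taylor series. -/
theorem iteratedDeriv_eq_of_hasSum {f : ℂ → ℂ} {a : ℕ → ℂ}
    (hf : DifferentiableOn ℂ f (Metric.ball 0 1))
    (ha : ∀ z : ℂ, ‖z‖ < 1 → HasSum (fun n => a n * z ^ n) (f z)) (n : ℕ) :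
    iteratedDeriv n f 0 = n.factorial * a n := by
  have hev : ∀ᶠ z : ℂ in nhds 0, ‖z‖ < 1 := by
    filter_upwards [Metric.ball_mem_nhds (0 : ℂ) one_pos] with z hz
    simpa using hz
  have h1 : HasFPowerSeriesAt f (.ofScalars ℂ a) 0 := by
    rw [hasFPowerSeriesAt_iff]
    filter_upwards [hev] with z hz
    simpa [mul_comm] using ha z hz
  have h2 : HasFPowerSeriesAt f
      (.ofScalars ℂ fun n => (n.factorial : ℂ)⁻¹ * iteratedDeriv n f 0) 0 := by
    rw [hasFPowerSeriesAt_iff]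
    filter_upwards [hev] with z hz
    have := Complex.hasSum_taylorSeries_on_ball hf (z := z) (by simpa using hz)
    simpa [mul_left_comm] using this
  have h3 := h2.eq_formalMultilinearSeries h1
  have h4 := congrArg (fun p => FormalMultilinearSeries.coeff p n) h3
  simp only [FormalMultilinearSeries.coeff_ofScalars] at h4
  rw [← h4, mul_inv_cancel_left₀ (by exact_mod_cast n.factorial_ne_zero)]

theorem hasSum_deriv_deriv {f : ℂ → ℂ} {a : ℕ → ℂ}
    (hf : DifferentiableOn ℂ f (Metric.ball 0 1))
    (ha : ∀ z : ℂ, ‖z‖ < 1 → HasSum (fun n => a n * z ^ n) (f z)) {z : ℂ} (hz : ‖z‖ < 1) :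
    HasSum (fun n : ℕ => ((n : ℂ) + 1) * (n + 2) * a (n + 2) * z ^ n) (deriv (deriv f) z) := by
  have h2 := (hf.deriv Metric.isOpen_ball).deriv Metric.isOpen_ball
  have h := Complex.hasSum_taylorSeries_on_ball h2 (z := z) (by simpa using hz)
  refine h.congr_fun fun n => ?_
  rw [← iteratedDeriv_succ', ← iteratedDeriv_succ', iteratedDeriv_eq_of_hasSum hf ha,
    Nat.factorial_succ, Nat.factorial_succ]
  have h1 : (n.factorial : ℂ) ≠ 0 := by exact_mod_cast n.factorial_ne_zero
  push_cast
  simp only [smul_eq_mul, sub_zero]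
  field_simp
  ring

/-! ### The function `₂F₁(1 + α, 2 - α; 2; z)` -/

/-- `₂F₁(1 + α, 2 - α; 2; z)` on the cut plane. -/
def gaussPhi (al : ℂ) : ℂ → ℂ := hyp2F1 (1 + al) (2 - al) 2

theorem isGaussContinuation_symm {a b c : ℂ} {F : ℂ → ℂ} (h : IsGaussContinuation a b c F) :
    IsGaussContinuation b a c F := by
  refine ⟨h.1, fun z hz => ?_⟩
  rw [h.2 z hz, ordinaryHypergeometric, ordinaryHypergeometric, ordinaryHypergeometricSeries_symm]

theorem isGaussContinuation_hyp2F1 {a b c : ℂ} {F : ℂ → ℂ} (h : IsGaussContinuation a b c F) :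
    IsGaussContinuation a b c (hyp2F1 a b c) := by
  have he := h.eqOn_hyp2F1
  exact ⟨h.1.congr fun z hz => (he hz).symm,
    fun z hz => by rw [← he (ball_subset_cutPlane hz), h.2 z hz]⟩

/-- The upper parameters are exchanged: with `b = 1 + α` both `b` and `2 - b = 1 - α` have positive
real part, whereas `b = 2 - α` would require `Re α > 0`. -/
theorem isGaussContinuation_euler_phi {al : ℂ} (h1 : -1 < al.re) (h2 : al.re < 1) :
    IsGaussContinuation (1 + al) (2 - al) 2 (eulerIntegral (2 - al) (1 + al) 2) := by
  refine isGaussContinuation_symm (isGaussContinuation_eulerIntegral ?_ ?_)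
  · simp only [Complex.add_re, Complex.one_re]; linarith
  · simp only [Complex.sub_re, Complex.add_re, Complex.one_re, Complex.re_ofNat]; linarith

theorem isGaussContinuation_gaussPhi {al : ℂ} (h1 : -1 < al.re) (h2 : al.re < 1) :
    IsGaussContinuation (1 + al) (2 - al) 2 (gaussPhi al) :=
  isGaussContinuation_hyp2F1 (isGaussContinuation_euler_phi h1 h2)

theorem gaussPhi_eq_eulerIntegral {al : ℂ} (h1 : -1 < al.re) (h2 : al.re < 1) {z : ℂ}
    (hz : z ∈ cutPlane) : gaussPhi al z = eulerIntegral (2 - al) (1 + al) 2 z :=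
  ((isGaussContinuation_euler_phi h1 h2).eqOn_hyp2F1 hz).symm

theorem differentiableOn_gaussPhi {al : ℂ} (h1 : -1 < al.re) (h2 : al.re < 1) :
    DifferentiableOn ℂ (gaussPhi al) cutPlane :=
  (isGaussContinuation_gaussPhi h1 h2).1

theorem hasSum_gaussPhi {al : ℂ} (h1 : -1 < al.re) (h2 : al.re < 1) {z : ℂ} (hz : ‖z‖ < 1) :
    HasSum (fun n => phiCoeff al n * z ^ n) (gaussPhi al z) := by
  rw [gaussPhi_eq_eulerIntegral h1 h2 (ball_subset_cutPlane (by simpa using hz))]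
  refine (hasSum_eulerIntegral ?_ ?_ hz).congr_fun fun n => ?_
  · simp only [Complex.add_re, Complex.one_re]; linarith
  · simp only [Complex.sub_re, Complex.add_re, Complex.one_re, Complex.re_ofNat]; linarith
  · simp only [phiCoeff, ordinaryHypergeometricCoefficient]
    ring

theorem gaussPhi_zero {al : ℂ} (h1 : -1 < al.re) (h2 : al.re < 1) : gaussPhi al 0 = 1 := by
  rw [(isGaussContinuation_gaussPhi h1 h2).2 0 (by simp), ordinaryHypergeometric_zero]

theorem hasSum_one_sub_mul_gaussPhi {al : ℂ} (h1 : -1 < al.re) (h2 : al.re < 1) {z : ℂ}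
    (hz : ‖z‖ < 1) :
    HasSum (fun n => ordinaryHypergeometricCoefficient al (1 - al) 2 n * z ^ n)
      ((1 - z) * gaussPhi al z) := by
  have h := hasSum_gaussPhi h1 h2 hz
  have h' := (hasSum_nat_add_iff' 1).mpr h
  refine (hasSum_nat_add_iff' 1).mp ?_
  have := h'.sub (h.mul_left z)
  simp only [Finset.range_one, Finset.sum_singleton, pow_zero, mul_one, phiCoeff_zero] at this ⊢
  have h0 : ordinaryHypergeometricCoefficient al (1 - al) 2 0 = 1 := by
    simp [ordinaryHypergeometricCoefficient]
  rw [h0]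
  convert this using 1
  · ext n
    rw [ordinaryHypergeometricCoefficient_succ_eq_sub]
    ring
  · ring

/-- Euler's transformation for the parameters `α, 1 - α; 2`. -/
theorem isGaussContinuation_one_sub_mul_gaussPhi {al : ℂ} (h1 : -1 < al.re) (h2 : al.re < 1) :
    IsGaussContinuation al (1 - al) 2 (fun z => (1 - z) * gaussPhi al z) := by
  refine ⟨DifferentiableOn.mul (by fun_prop) (differentiableOn_gaussPhi h1 h2), fun z hz => ?_⟩
  rw [ordinaryHypergeometric_eq_tsum]
  exact (hasSum_one_sub_mul_gaussPhi h1 h2 (by simpa using hz)).tsum_eq.symm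

/-- The hypergeometric equation in self-adjoint form: the second derivative of `z (1 - z) F` is
`α (1 - α) F`. -/
theorem deriv_deriv_mul_gaussPhi {al : ℂ} (h1 : -1 < al.re) (h2 : al.re < 1) {z : ℂ}
    (hz : z ∈ cutPlane) :
    deriv (deriv fun z => z * (1 - z) * gaussPhi al z) z = al * (1 - al) * gaussPhi al z := by
  have hF := differentiableOn_gaussPhi h1 h2
  have hY : DifferentiableOn ℂ (fun z => z * (1 - z) * gaussPhi al z) cutPlane :=
    DifferentiableOn.mul (by fun_prop) hF
  have hY2 := (hY.deriv isOpen_cutPlane).deriv isOpen_cutPlane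
  refine AnalyticOnNhd.eqOn_of_preconnected_of_eventuallyEq
    (hY2.analyticOnNhd isOpen_cutPlane) ((hF.const_mul (al * (1 - al))).analyticOnNhd isOpen_cutPlane)
    isPreconnected_cutPlane zero_mem_cutPlane ?_ hz
  filter_upwards [Metric.ball_mem_nhds (0 : ℂ) one_pos] with w hw
  have hw' : ‖w‖ < 1 := by simpa using hw
  -- Multiplication by `z` shifts the coefficients of `(1-z)F` by one. After two differentiations
  -- the `n`-th coefficient is therefore `(n+1)(n+2)` times the coefficient of index `n + 1` of
  -- `₂F₁(α, 1-α; 2)`.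
  have hsum : ∀ z : ℂ, ‖z‖ < 1 → HasSum (fun n : ℕ => (if n = 0 then 0 else
      ordinaryHypergeometricCoefficient al (1 - al) 2 (n - 1)) * z ^ n)
      (z * (1 - z) * gaussPhi al z) := by
    intro z hz
    refine (hasSum_nat_add_iff' 1).mp ?_
    have := (hasSum_one_sub_mul_gaussPhi h1 h2 hz).mul_left z
    have h0 : z * (1 - z) * gaussPhi al z - ∑ i ∈ Finset.range 1, (if i = 0 then 0 else
        ordinaryHypergeometricCoefficient al (1 - al) 2 (i - 1)) * z ^ i =
        z * ((1 - z) * gaussPhi al z) := by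
      simp
      ring
    rw [h0]
    refine this.congr_fun fun n => ?_
    rw [if_neg n.succ_ne_zero, Nat.add_sub_cancel]
    ring
  have h3 := hasSum_deriv_deriv (hY.mono ball_subset_cutPlane) hsum hw'
  refine h3.unique ?_
  refine ((hasSum_gaussPhi h1 h2 hw').mul_left (al * (1 - al))).congr_fun fun n => ?_
  have h4 := succ_mul_ordinaryHypergeometricCoefficient al n
  have h5 : n + 2 - 1 = n + 1 := rfl
  simp only [Nat.add_eq_zero_iff, OfNat.ofNat_ne_zero, and_false, if_false, h5]
  rw [h4]
  ring

/-! ### Decay on the half-line -/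

theorem neg_mem_cutPlane {z : ℂ} (hz : -1 < z.re) : -z ∈ cutPlane := by
  refine Complex.mem_slitPlane_iff.mpr (Or.inl ?_)
  simp only [sub_neg_eq_add, Complex.add_re, Complex.one_re]
  linarith

/-- In Euler's integral `(1+xu)^(-Re(2-α)) ≤ (1+xu)^(-s) ≤ u^(-s) (1+x)^(-s)`, because `u(1+x) ≤
1+xu` on `[0, 1]`. The factor `u^(-s)` lowers the first Beta exponent to `1 + α - s`, and the
integral still converges since `s < 1 + Re α`. -/
theorem norm_gaussPhi_neg_le {al : ℂ} (h1 : -1 < al.re) (h2 : al.re < 1) {s : ℝ} (hs0 : 0 < s)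
    (hs1 : s < 1) (hs2 : s < 1 + al.re) :
    ∃ C : ℝ, 0 ≤ C ∧ ∀ x : ℝ, 0 ≤ x → ‖gaussPhi al (-(x : ℂ))‖ ≤ C * (1 + x) ^ (-s) := by
  have hb : 0 < (1 + al - s).re := by
    simp only [Complex.add_re, Complex.sub_re, Complex.one_re, Complex.ofReal_re]; linarith
  have hcb : 0 < (2 - (1 + al)).re := by
    simp only [Complex.sub_re, Complex.add_re, Complex.one_re, Complex.re_ofNat]; linarith
  have hw := intervalIntegrable_betaWeight hb hcb
  refine ⟨‖(Complex.betaIntegral (1 + al) (2 - (1 + al)))⁻¹‖ *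
    ∫ u in (0 : ℝ)..1, ‖betaWeight (1 + al - s) (2 - (1 + al)) u‖,
    mul_nonneg (norm_nonneg _) (intervalIntegral.integral_nonneg zero_le_one
      fun _ _ => norm_nonneg _), fun x hx => ?_⟩
  have hxc : -(x : ℂ) ∈ cutPlane := neg_mem_cutPlane (by rw [Complex.ofReal_re]; linarith)
  rw [gaussPhi_eq_eulerIntegral h1 h2 hxc, eulerIntegral, norm_mul, mul_assoc]
  refine mul_le_mul_of_nonneg_left ?_ (norm_nonneg _)
  rw [← intervalIntegral.integral_mul_const]
  refine intervalIntegral.norm_integral_le_of_norm_le zero_le_one ?_ (hw.norm.mul_const _)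
  refine Filter.Eventually.of_forall fun u hu => ?_
  have hu0 : 0 < u := hu.1
  have h1x : 0 < 1 + x := by linarith
  have hxu : 1 - -(x : ℂ) * u = ((1 + x * u : ℝ) : ℂ) := by push_cast; ring
  have hxu1 : 1 ≤ 1 + x * u := by nlinarith
  have hle : ‖(1 - -(x : ℂ) * u) ^ (-(2 - al))‖ ≤ u ^ (-s) * (1 + x) ^ (-s) := by
    rw [hxu, Complex.norm_cpow_eq_rpow_re_of_pos (by linarith), ← Real.mul_rpow hu0.le h1x.le]
    refine (Real.rpow_le_rpow_of_exponent_le hxu1 (z := -s) ?_).trans ?_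
    · simp only [Complex.neg_re, Complex.sub_re, Complex.re_ofNat]; linarith
    · exact Real.rpow_le_rpow_of_nonpos (by positivity) (by nlinarith [hu.2]) (by linarith)
  have hweq : ‖betaWeight (1 + al) (2 - (1 + al)) u‖ * u ^ (-s) =
      ‖betaWeight (1 + al - s) (2 - (1 + al)) u‖ := by
    rw [betaWeight, betaWeight, norm_mul, norm_mul, Complex.norm_cpow_eq_rpow_re_of_pos hu0,
      Complex.norm_cpow_eq_rpow_re_of_pos hu0, mul_right_comm, ← Real.rpow_add hu0]
    congr 2
    simp only [Complex.sub_re, Complex.add_re, Complex.one_re, Complex.ofReal_re]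
    ring
  rw [norm_mul, ← hweq, mul_assoc]
  exact mul_le_mul_of_nonneg_left hle (norm_nonneg _)

theorem integrableOn_one_add_rpow {r : ℝ} (hr : 1 < r) :
    IntegrableOn (fun t : ℝ => (1 + t) ^ (-r)) (Set.Ioi 0) := by
  simpa [add_comm] using integrableOn_add_rpow_Ioi_of_lt (a := -r) (c := 0) (m := 1)
    (by linarith) (by norm_num)

theorem continuousOn_gaussPhi_neg {al : ℂ} (h1 : -1 < al.re) (h2 : al.re < 1) :
    ContinuousOn (fun t : ℝ => gaussPhi al (-(t : ℂ))) (Set.Ioi (-1)) :=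
  (differentiableOn_gaussPhi h1 h2).continuousOn.comp (f := fun t : ℝ => -(t : ℂ)) (by fun_prop)
    fun t ht => neg_mem_cutPlane (by simpa using ht)

theorem aestronglyMeasurable_gaussPhi_neg {al : ℂ} (h1 : -1 < al.re) (h2 : al.re < 1) :
    AEStronglyMeasurable (fun t : ℝ => gaussPhi al (-(t : ℂ))) volPos :=
  ((continuousOn_gaussPhi_neg h1 h2).mono
    (Set.Ioi_subset_Ioi (by norm_num))).aestronglyMeasurable measurableSet_Ioi

theorem integrable_mul_of_decay {f k : ℝ → ℂ} {C K s : ℝ} (hs : 0 < s) (hC : 0 ≤ C)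
    (hf : AEStronglyMeasurable f volPos) (hfb : ∀ t : ℝ, 0 ≤ t → ‖f t‖ ≤ C * (1 + t) ^ (-s))
    (hk : AEStronglyMeasurable k volPos) (hkb : ∀ t : ℝ, 0 < t → ‖k t‖ ≤ K * (1 + t)⁻¹) :
    Integrable (fun t => f t * k t) volPos := by
  have hi : Integrable (fun t : ℝ => (C * K) * (1 + t) ^ (-(s + 1))) volPos :=
    (integrableOn_one_add_rpow (r := s + 1) (by linarith)).const_mul _
  refine hi.mono' (hf.mul hk) ((ae_restrict_mem measurableSet_Ioi).mono fun t ht => ?_)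
  have ht0 : (0 : ℝ) < t := ht
  have h1t : 0 < 1 + t := by linarith
  rw [norm_mul, neg_add, Real.rpow_add h1t, Real.rpow_neg_one]
  calc ‖f t‖ * ‖k t‖ ≤ (C * (1 + t) ^ (-s)) * (K * (1 + t)⁻¹) :=
        mul_le_mul (hfb t ht0.le) (hkb t ht0) (norm_nonneg _) (by positivity)
    _ = _ := by ring

theorem memLp_two_of_decay {f : ℝ → ℂ} {C s : ℝ} (hs : 1 / 2 < s)
    (hf : AEStronglyMeasurable f volPos) (hfb : ∀ t : ℝ, 0 ≤ t → ‖f t‖ ≤ C * (1 + t) ^ (-s)) :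
    MemLp f 2 volPos := by
  refine (memLp_two_iff_integrable_sq_norm hf).mpr ?_
  have hi : Integrable (fun t : ℝ => C ^ 2 * (1 + t) ^ (-(2 * s))) volPos :=
    (integrableOn_one_add_rpow (r := 2 * s) (by linarith)).const_mul _
  refine hi.mono' (hf.norm.pow 2) ((ae_restrict_mem measurableSet_Ioi).mono fun t ht => ?_)
  have ht0 : (0 : ℝ) < t := ht
  have h1t : 0 < 1 + t := by linarith
  rw [Real.norm_of_nonneg (by positivity)]
  have h3 : (1 + t) ^ (-(2 * s)) = ((1 + t) ^ (-s)) ^ 2 := by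
    rw [← Real.rpow_natCast, ← Real.rpow_mul h1t.le]
    congr 1
    push_cast
    ring
  rw [h3, ← mul_pow]
  exact pow_le_pow_left₀ (norm_nonneg _) (hfb t ht0.le) 2

/-! ### Moments -/

/-- The moments `∫₀^∞ φ(t) (1 + t) ^ (-n - 1) dt`. -/
def phiMoment (al : ℂ) (n : ℕ) : ℂ :=
  ∫ t : ℝ, gaussPhi al (-(t : ℂ)) * ((1 + (t : ℂ)) ^ (n + 1))⁻¹ ∂volPos

/-- The derivative of `x (1 + x) φ(x)`. -/
def phiDeriv (al : ℂ) (t : ℝ) : ℂ :=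
  deriv (fun z => z * (1 - z) * gaussPhi al z) (-(t : ℂ))

theorem hasDerivAt_mul_gaussPhi_neg {al : ℂ} (h1 : -1 < al.re) (h2 : al.re < 1) {t : ℝ}
    (ht : -1 < t) :
    HasDerivAt (fun t : ℝ => (t : ℂ) * (1 + t) * gaussPhi al (-(t : ℂ))) (phiDeriv al t) t := by
  have hm : -(t : ℂ) ∈ cutPlane := neg_mem_cutPlane (by simpa using ht)
  have hY : DifferentiableOn ℂ (fun z => z * (1 - z) * gaussPhi al z) cutPlane :=
    DifferentiableOn.mul (by fun_prop) (differentiableOn_gaussPhi h1 h2)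
  have hd := (hY.differentiableAt (isOpen_cutPlane.mem_nhds hm)).hasDerivAt
  have h3 : HasDerivAt (fun t : ℝ => -(t : ℂ)) (-1) t := (Complex.ofRealCLM.hasDerivAt (x := t)).neg
  have h4 := (hd.comp t h3).neg
  refine (h4.congr_deriv ?_).congr_of_eventuallyEq (Filter.Eventually.of_forall fun u => ?_)
  · simp [phiDeriv]
  · simp only [Pi.neg_apply, Function.comp_apply]
    ring

theorem hasDerivAt_phiDeriv {al : ℂ} (h1 : -1 < al.re) (h2 : al.re < 1) {t : ℝ} (ht : -1 < t) :
    HasDerivAt (phiDeriv al) (-(al * (1 - al) * gaussPhi al (-(t : ℂ)))) t := by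
  have hm : -(t : ℂ) ∈ cutPlane := neg_mem_cutPlane (by simpa using ht)
  have hY : DifferentiableOn ℂ (fun z => z * (1 - z) * gaussPhi al z) cutPlane :=
    DifferentiableOn.mul (by fun_prop) (differentiableOn_gaussPhi h1 h2)
  have hd := ((hY.deriv isOpen_cutPlane).differentiableAt
    (isOpen_cutPlane.mem_nhds hm)).hasDerivAt
  rw [deriv_deriv_mul_gaussPhi h1 h2 hm] at hd
  have h3 : HasDerivAt (fun t : ℝ => -(t : ℂ)) (-1) t := (Complex.ofRealCLM.hasDerivAt (x := t)).neg
  refine (hd.comp t h3).congr_deriv ?_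
  ring

theorem phiDeriv_zero {al : ℂ} (h1 : -1 < al.re) (h2 : al.re < 1) : phiDeriv al 0 = 1 := by
  have hd : HasDerivAt (gaussPhi al) (deriv (gaussPhi al) 0) 0 :=
    ((differentiableOn_gaussPhi h1 h2).differentiableAt
      (isOpen_cutPlane.mem_nhds zero_mem_cutPlane)).hasDerivAt
  have h3 : HasDerivAt (fun z : ℂ => z * (1 - z)) 1 0 := by
    have := (hasDerivAt_id' (0 : ℂ)).fun_mul ((hasDerivAt_id' (0 : ℂ)).const_sub 1)
    simpa using this
  have h4 := (h3.mul hd).deriv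
  rw [phiDeriv, Complex.ofReal_zero, neg_zero]
  refine h4.trans ?_
  simp [gaussPhi_zero h1 h2]

/-- The derivative of `phiDeriv` is `-α(1-α)φ`, so the decay of `φ` is integrated from the initial
value `1` at `0`. -/
theorem norm_phiDeriv_le {al : ℂ} (h1 : -1 < al.re) (h2 : al.re < 1) {C s : ℝ} (hs1 : s < 1)
    (hC0 : 0 ≤ C) (hC : ∀ x : ℝ, 0 ≤ x → ‖gaussPhi al (-(x : ℂ))‖ ≤ C * (1 + x) ^ (-s))
    {t : ℝ} (ht : 0 ≤ t) :
    ‖phiDeriv al t‖ ≤ 1 + ‖al * (1 - al)‖ * C / (1 - s) * (1 + t) ^ (1 - s) := by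
  have hs' : 0 < 1 - s := by linarith
  have hB : ∀ x : ℝ, 0 ≤ x → HasDerivAt
      (fun x : ℝ => 1 + ‖al * (1 - al)‖ * C / (1 - s) * (1 + x) ^ (1 - s))
      (‖al * (1 - al)‖ * (C * (1 + x) ^ (-s))) x := by
    intro x hx
    have h3 : HasDerivAt (fun x : ℝ => 1 + x) 1 x := (hasDerivAt_id x).const_add 1
    have h4 := ((h3.rpow_const (p := 1 - s) (Or.inl (by linarith))).const_mul
      (‖al * (1 - al)‖ * C / (1 - s))).const_add 1
    refine h4.congr_deriv ?_
    rw [show 1 - s - 1 = -s by ring]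
    field_simp
  refine image_norm_le_of_norm_deriv_right_le_deriv_boundary' (f := phiDeriv al)
    (f' := fun t => -(al * (1 - al) * gaussPhi al (-(t : ℂ)))) (a := 0) (b := t)
    (B := fun x : ℝ => 1 + ‖al * (1 - al)‖ * C / (1 - s) * (1 + x) ^ (1 - s))
    (B' := fun x => ‖al * (1 - al)‖ * (C * (1 + x) ^ (-s))) ?_ ?_ ?_ ?_ ?_ ?_ ⟨ht, le_rfl⟩
  · exact fun x hx => (hasDerivAt_phiDeriv h1 h2 (by linarith [hx.1])).continuousAt.continuousWithinAt
  · exact fun x hx => (hasDerivAt_phiDeriv h1 h2 (by linarith [hx.1])).hasDerivWithinAt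
  · rw [phiDeriv_zero h1 h2, norm_one]
    have : 0 ≤ ‖al * (1 - al)‖ * C / (1 - s) * (1 + 0) ^ (1 - s) := by positivity
    linarith
  · exact fun x hx => (hB x hx.1).continuousAt.continuousWithinAt
  · exact fun x hx => (hB x hx.1).hasDerivWithinAt
  · intro x hx
    rw [norm_neg, norm_mul]
    exact mul_le_mul_of_nonneg_left (hC x hx.1) (norm_nonneg _)

/-- An exponent above `1/2` makes `φ` square-integrable; one below `1` keeps the integrated bound
for `phiDeriv` a power. -/
theorem exists_decay_gaussPhi {al : ℂ} (h1 : -(1 / 2) < al.re) (h2 : al.re < 1) :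
    ∃ s C : ℝ, 1 / 2 < s ∧ s < 1 ∧ 0 ≤ C ∧
      ∀ x : ℝ, 0 ≤ x → ‖gaussPhi al (-(x : ℂ))‖ ≤ C * (1 + x) ^ (-s) := by
  obtain ⟨s, hs, hs'⟩ := exists_between (show (1 / 2 : ℝ) < min 1 (1 + al.re) from
    lt_min (by norm_num) (by linarith))
  obtain ⟨C, hC0, hC⟩ := norm_gaussPhi_neg_le (by linarith) h2 (by linarith : 0 < s)
    (hs'.trans_le (min_le_left _ _)) (hs'.trans_le (min_le_right _ _))
  exact ⟨s, C, hs, hs'.trans_le (min_le_left _ _), hC0, hC⟩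

theorem one_add_ofReal_ne_zero {t : ℝ} (ht : 0 ≤ t) : (1 + (t : ℂ)) ≠ 0 := by
  have : (1 + t : ℝ) ≠ 0 := by linarith
  exact_mod_cast this

theorem norm_one_add_ofReal {t : ℝ} (ht : 0 ≤ t) : ‖1 + (t : ℂ)‖ = 1 + t := by
  have h : 1 + (t : ℂ) = ((1 + t : ℝ) : ℂ) := by push_cast; ring
  rw [h, Complex.norm_real, Real.norm_of_nonneg (by linarith)]

theorem norm_inv_one_add_pow_le {t : ℝ} (ht : 0 ≤ t) (n : ℕ) :
    ‖((1 + (t : ℂ)) ^ (n + 1))⁻¹‖ ≤ (1 + t)⁻¹ := by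
  rw [norm_inv, norm_pow, norm_one_add_ofReal ht]
  have h1 : (1 : ℝ) ≤ 1 + t := by linarith
  exact inv_anti₀ (by linarith) (le_self_pow₀ h1 n.succ_ne_zero)

theorem measurable_inv_one_add_pow (n : ℕ) :
    Measurable fun t : ℝ => ((1 + (t : ℂ)) ^ (n + 1))⁻¹ := by
  fun_prop

theorem integrable_phiMoment {al : ℂ} (h1 : -(1 / 2) < al.re) (h2 : al.re < 1) (n : ℕ) :
    Integrable (fun t : ℝ => gaussPhi al (-(t : ℂ)) * ((1 + (t : ℂ)) ^ (n + 1))⁻¹) volPos := by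
  obtain ⟨s, C, hs, hs1, hC0, hC⟩ := exists_decay_gaussPhi h1 h2
  refine integrable_mul_of_decay (K := 1) (by linarith : 0 < s) hC0
    (aestronglyMeasurable_gaussPhi_neg (by linarith) h2) hC
    (measurable_inv_one_add_pow n).aestronglyMeasurable fun t ht => ?_
  rw [one_mul]
  exact norm_inv_one_add_pow_le ht.le n

theorem tendsto_one_add_rpow_neg {s : ℝ} (hs : 0 < s) :
    Filter.Tendsto (fun t : ℝ => (1 + t) ^ (-s)) Filter.atTop (nhds 0) :=
  (tendsto_rpow_neg_atTop hs).comp (Filter.tendsto_atTop_add_const_left _ 1 Filter.tendsto_id)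

/-- These are the boundary terms `k Y' - k' Y` of the double integration by parts, with `k =
(1+t)^(-n-1)` and `Y = t(1+t)φ`. Here `Y'` grows at most like `(1+t)^(1-s)`, while `-k'` times
`t(1+t)` is bounded. -/
theorem tendsto_phiMoment_boundary {al : ℂ} (h1 : -(1 / 2) < al.re) (h2 : al.re < 1) (n : ℕ) :
    Filter.Tendsto (fun t : ℝ => ((1 + (t : ℂ)) ^ (n + 1))⁻¹ * phiDeriv al t +
      (n + 1) * ((1 + (t : ℂ)) ^ (n + 2))⁻¹ * ((t : ℂ) * (1 + t) * gaussPhi al (-(t : ℂ))))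
      Filter.atTop (nhds 0) := by
  obtain ⟨s, C, hs, hs1, hC0, hC⟩ := exists_decay_gaussPhi h1 h2
  set D := ‖al * (1 - al)‖ * C / (1 - s) with hD
  have hlim : Filter.Tendsto (fun t : ℝ => (1 + t) ^ (-(1 : ℝ)) + D * (1 + t) ^ (-s) +
      (n + 1) * (C * (1 + t) ^ (-s))) Filter.atTop (nhds 0) := by
    have hs0 := tendsto_one_add_rpow_neg (by linarith : 0 < s)
    have := ((tendsto_one_add_rpow_neg one_pos).add (hs0.const_mul D)).add
      ((hs0.const_mul C).const_mul ((n : ℝ) + 1))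
    simpa using this
  refine squeeze_zero_norm' ?_ hlim
  filter_upwards [Filter.eventually_ge_atTop 0] with t ht
  have h1t : 0 < 1 + t := by linarith
  have hE := norm_phiDeriv_le (by linarith) h2 hs1 hC0 hC ht
  refine (norm_add_le _ _).trans (add_le_add ?_ ?_)
  · rw [norm_mul]
    refine (mul_le_mul (norm_inv_one_add_pow_le ht n) hE (norm_nonneg _) (by positivity)).trans
      (le_of_eq ?_)
    rw [← hD, mul_add, mul_one, Real.rpow_neg_one, mul_left_comm, ← Real.rpow_neg_one,
      ← Real.rpow_add h1t]
    ring_nf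
  · rw [norm_mul, norm_mul, norm_mul, mul_assoc]
    have hn : ‖(n : ℂ) + 1‖ = n + 1 := by
      rw [← Nat.cast_succ, Complex.norm_natCast, Nat.cast_succ]
    rw [hn]
    refine mul_le_mul_of_nonneg_left ?_ (by positivity)
    rw [← mul_assoc]
    have hk : ‖((1 + (t : ℂ)) ^ (n + 2))⁻¹‖ * ‖(t : ℂ) * (1 + t)‖ ≤ 1 := by
      rw [norm_inv, norm_pow, norm_mul, norm_one_add_ofReal ht, Complex.norm_real,
        Real.norm_of_nonneg ht, inv_mul_le_iff₀ (by positivity), mul_one, pow_add]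
      have h3 : (1 : ℝ) ≤ (1 + t) ^ n := one_le_pow₀ (by linarith)
      nlinarith [mul_pos h1t h1t]
    calc _ ≤ 1 * ‖gaussPhi al (-(t : ℂ))‖ := mul_le_mul_of_nonneg_right hk (norm_nonneg _)
      _ ≤ _ := by rw [one_mul]; exact hC t ht

theorem hasDerivAt_inv_one_add_pow (n : ℕ) {t : ℝ} (ht : 0 ≤ t) :
    HasDerivAt (fun t : ℝ => ((1 + (t : ℂ)) ^ (n + 1))⁻¹)
      (-((n : ℂ) + 1) * ((1 + (t : ℂ)) ^ (n + 2))⁻¹) t := by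
  have h0 := one_add_ofReal_ne_zero ht
  have h3 : HasDerivAt (fun t : ℝ => 1 + (t : ℂ)) 1 t :=
    (Complex.ofRealCLM.hasDerivAt (x := t)).const_add 1
  refine ((h3.fun_pow (n + 1)).fun_inv (pow_ne_zero _ h0)).congr_deriv ?_
  rw [Nat.add_sub_cancel]
  field_simp
  push_cast
  ring

/-- Green's formula for `k = (1+t)^(-n-1)` and `Y = t(1+t)φ`: the function `k Y' - k' Y` has
derivative `k Y'' - k'' Y`, a combination of two moment integrands because `t(1+t) = (1+t)² -
(1+t)`. It vanishes at infinity and equals `Y'(0) = 1` at `0`, whence the `-1`. -/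
theorem phiMoment_succ {al : ℂ} (h1 : -(1 / 2) < al.re) (h2 : al.re < 1) (n : ℕ) :
    ((n : ℂ) + 1) * (n + 2) * phiMoment al (n + 1) =
      ((n + 1) * (n + 2) + al * (1 - al)) * phiMoment al n - 1 := by
  have h1' : -1 < al.re := by linarith
  have hi := integrable_phiMoment h1 h2 n
  have hi' := integrable_phiMoment h1 h2 (n + 1)
  have key := integral_Ioi_of_hasDerivAt_of_tendsto' (a := 0)
    (f := fun t : ℝ => ((1 + (t : ℂ)) ^ (n + 1))⁻¹ * phiDeriv al t +
      (n + 1) * ((1 + (t : ℂ)) ^ (n + 2))⁻¹ * ((t : ℂ) * (1 + t) * gaussPhi al (-(t : ℂ))))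
    (f' := fun t : ℝ => ((n : ℂ) + 1) * (n + 2) *
        (gaussPhi al (-(t : ℂ)) * ((1 + (t : ℂ)) ^ (n + 1 + 1))⁻¹) -
      ((n + 1) * (n + 2) + al * (1 - al)) *
        (gaussPhi al (-(t : ℂ)) * ((1 + (t : ℂ)) ^ (n + 1))⁻¹)) (m := 0) ?_ ?_
    (tendsto_phiMoment_boundary h1 h2 n)
  · change ∫ t, _ ∂volPos = _ at key
    rw [integral_sub (hi'.const_mul _) (hi.const_mul _), integral_const_mul,
      integral_const_mul, Complex.ofReal_zero, phiDeriv_zero h1' h2] at key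
    rw [phiMoment, phiMoment]
    simp only [add_zero, one_pow, inv_one, mul_one, zero_mul, mul_zero, zero_sub] at key
    linear_combination key
  · intro t ht
    have ht0 : 0 ≤ t := ht
    have h0 := one_add_ofReal_ne_zero ht0
    have hk2 := (hasDerivAt_inv_one_add_pow (n + 1) ht0).const_mul ((n : ℂ) + 1)
    refine (((hasDerivAt_inv_one_add_pow n ht0).fun_mul
      (hasDerivAt_phiDeriv h1' h2 (by linarith))).add
      (hk2.fun_mul (hasDerivAt_mul_gaussPhi_neg h1' h2 (by linarith)))).congr_deriv ?_
    push_cast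
    field_simp
    ring
  · exact (hi'.const_mul _).sub (hi.const_mul _)

theorem tendsto_phiMoment {al : ℂ} (h1 : -(1 / 2) < al.re) (h2 : al.re < 1) :
    Filter.Tendsto (phiMoment al) Filter.atTop (nhds 0) := by
  have hi := integrable_phiMoment h1 h2 0
  have key := tendsto_integral_of_dominated_convergence (μ := volPos)
    (F := fun (n : ℕ) (t : ℝ) => gaussPhi al (-(t : ℂ)) * ((1 + (t : ℂ)) ^ (n + 1))⁻¹)
    (f := fun _ => 0)
    (fun t => ‖gaussPhi al (-(t : ℂ)) * ((1 + (t : ℂ)) ^ (0 + 1))⁻¹‖)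
    (fun n => (integrable_phiMoment h1 h2 n).aestronglyMeasurable) hi.norm ?_ ?_
  · rw [integral_zero] at key
    exact key
  · intro n
    refine (ae_restrict_mem measurableSet_Ioi).mono fun t ht => ?_
    have ht0 : (0 : ℝ) ≤ t := le_of_lt ht
    rw [norm_mul, norm_mul]
    refine mul_le_mul_of_nonneg_left ((norm_inv_one_add_pow_le ht0 n).trans (le_of_eq ?_))
      (norm_nonneg _)
    rw [zero_add, pow_one, norm_inv, norm_one_add_ofReal ht0]
  · refine (ae_restrict_mem measurableSet_Ioi).mono fun t ht => ?_
    have ht0 : (0 : ℝ) < t := ht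
    have hlt : ‖(1 + (t : ℂ))⁻¹‖ < 1 := by
      rw [norm_inv, norm_one_add_ofReal ht0.le]
      exact inv_lt_one_of_one_lt₀ (by linarith)
    have := ((tendsto_pow_atTop_nhds_zero_of_norm_lt_one hlt).comp
      (Filter.tendsto_add_atTop_nat 1)).const_mul (gaussPhi al (-(t : ℂ)))
    simpa [Function.comp_def, inv_pow] using this

/-- The moments of `φ` against its Taylor coefficients. -/
theorem phiCoeff_add_phiMoment {al c : ℂ} {lam : ℂ} (h1 : -(1 / 2) < al.re) (h2 : al.re < 1)
    (hc : c ≠ 0) (hlam : c * (al * (1 - al)) = lam)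
    (hlim : Filter.Tendsto (phiCoeff al) Filter.atTop (nhds c)) (n : ℕ) :
    phiCoeff al n + lam * phiMoment al n = c := by
  -- The defect obeys the recursion of `phiCoeff`, since the inhomogeneity `c α(1-α) - λ` vanishes.
  -- As `phiCoeff al 0 = 1`, the factor is the defect at `0`.
  have hprop : ∀ n, phiCoeff al n + lam * phiMoment al n - c =
      (phiCoeff al 0 + lam * phiMoment al 0 - c) * phiCoeff al n := by
    intro n
    induction n with
    | zero => rw [phiCoeff_zero, mul_one]
    | succ n ih =>
      have h3 : (n : ℂ) + 1 ≠ 0 := by exact_mod_cast n.succ_ne_zero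
      have h4 : (n : ℂ) + 2 ≠ 0 := by exact_mod_cast (Nat.succ_ne_zero (n + 1))
      refine mul_left_cancel₀ (mul_ne_zero h3 h4) ?_
      linear_combination (1 - (phiCoeff al 0 + lam * phiMoment al 0 - c)) * phiCoeff_succ al n +
        lam * phiMoment_succ h1 h2 n + (((n : ℂ) + 1) * (n + 2) + al * (1 - al)) * ih + hlam
  have hl : Filter.Tendsto (fun n => phiCoeff al n + lam * phiMoment al n - c) Filter.atTop
      (nhds (c + lam * 0 - c)) :=
    (hlim.add ((tendsto_phiMoment h1 h2).const_mul lam)).sub_const c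
  have hr := hlim.const_mul (phiCoeff al 0 + lam * phiMoment al 0 - c)
  -- The defect tends to `0`, and also to its initial value times `c`; as `c ≠ 0`, the initial value
  -- is zero.
  have h0 := tendsto_nhds_unique (hl.congr hprop) hr
  have hz : phiCoeff al 0 + lam * phiMoment al 0 - c = 0 := by
    refine (mul_eq_zero.mp (h0.symm.trans (by ring))).resolve_right hc
  have := hprop n
  rw [hz, zero_mul] at this
  linear_combination this

/-! ### The integral equation -/

/-- The Stieltjes transform `∫₀^∞ φ(t) / (1 + t + z) dt`. -/
def phiStieltjes (al z : ℂ) : ℂ :=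
  ∫ t : ℝ, gaussPhi al (-(t : ℂ)) * (1 + (t : ℂ) + z)⁻¹ ∂volPos

/-- Since `‖z‖ < 1 ≤ 1 + t`, the kernel is the geometric series `∑ (-z)^n (1+t)^(-n-1)`, dominated
by `‖z‖^n/(1+t)`. -/
theorem hasSum_phiStieltjes {al : ℂ} (h1 : -(1 / 2) < al.re) (h2 : al.re < 1) {z : ℂ}
    (hz : ‖z‖ < 1) :
    HasSum (fun n => phiMoment al n * (-z) ^ n) (phiStieltjes al z) := by
  have hi := integrable_phiMoment h1 h2 0
  have key := hasSum_integral_of_dominated_convergence (μ := volPos)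
    (F := fun (n : ℕ) (t : ℝ) =>
      gaussPhi al (-(t : ℂ)) * ((1 + (t : ℂ)) ^ (n + 1))⁻¹ * (-z) ^ n)
    (f := fun t => gaussPhi al (-(t : ℂ)) * (1 + (t : ℂ) + z)⁻¹)
    (fun n t => ‖gaussPhi al (-(t : ℂ)) * ((1 + (t : ℂ)) ^ (0 + 1))⁻¹‖ * ‖z‖ ^ n)
    (fun n => (integrable_phiMoment h1 h2 n).aestronglyMeasurable.mul_const _) ?_ ?_ ?_ ?_
  · refine key.congr_fun fun n => ?_
    rw [integral_mul_const, phiMoment]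
  · intro n
    refine (ae_restrict_mem measurableSet_Ioi).mono fun t ht => ?_
    have ht0 : (0 : ℝ) ≤ t := le_of_lt ht
    rw [norm_mul, norm_mul, norm_mul, norm_pow, norm_neg]
    have h3 : ‖((1 + (t : ℂ)) ^ (n + 1))⁻¹‖ ≤ ‖((1 + (t : ℂ)) ^ (0 + 1))⁻¹‖ := by
      refine (norm_inv_one_add_pow_le ht0 n).trans (le_of_eq ?_)
      rw [zero_add, pow_one, norm_inv, norm_one_add_ofReal ht0]
    gcongr
  · exact Filter.Eventually.of_forall fun t =>
      (summable_geometric_of_lt_one (norm_nonneg z) hz).mul_left _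
  · simp_rw [tsum_mul_left]
    exact hi.norm.mul_const _
  · refine (ae_restrict_mem measurableSet_Ioi).mono fun t ht => ?_
    have ht0 : (0 : ℝ) < t := ht
    have h0 := one_add_ofReal_ne_zero ht0.le
    have hlt : ‖-z / (1 + (t : ℂ))‖ < 1 := by
      rw [norm_div, norm_neg, norm_one_add_ofReal ht0.le, div_lt_one (by linarith)]
      linarith
    have hg := (hasSum_geometric_of_norm_lt_one hlt).mul_left
      (gaussPhi al (-(t : ℂ)) * (1 + (t : ℂ))⁻¹)
    have hne : 1 - -z / (1 + (t : ℂ)) ≠ 0 := by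
      intro h
      rw [← sub_eq_zero.mp h, norm_one] at hlt
      exact lt_irrefl _ hlt
    have he : gaussPhi al (-(t : ℂ)) * (1 + (t : ℂ))⁻¹ * (1 - -z / (1 + (t : ℂ)))⁻¹ =
        gaussPhi al (-(t : ℂ)) * (1 + (t : ℂ) + z)⁻¹ := by
      rw [mul_assoc, ← mul_inv]
      congr 2
      field_simp
      ring
    rw [he] at hg
    refine hg.congr_fun fun n => ?_
    rw [div_pow, pow_succ, mul_inv]
    ring

theorem norm_inv_one_add_add_le {z : ℂ} {d : ℝ} (hd : 0 < d) (hz : -1 + d ≤ z.re) {t : ℝ}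
    (ht : 0 ≤ t) : ‖(1 + (t : ℂ) + z)⁻¹‖ ≤ (min 1 d)⁻¹ * (1 + t)⁻¹ := by
  have hm : 0 < min 1 d := lt_min one_pos hd
  rw [norm_inv, ← mul_inv]
  refine inv_anti₀ (by positivity) (le_trans ?_ (Complex.re_le_norm _))
  simp only [Complex.add_re, Complex.one_re, Complex.ofReal_re]
  nlinarith [min_le_left 1 d, min_le_right 1 d]

theorem one_add_add_ne_zero {z : ℂ} (hz : -1 < z.re) {t : ℝ} (ht : 0 ≤ t) :
    1 + (t : ℂ) + z ≠ 0 := by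
  intro h
  have := congrArg Complex.re h
  simp only [Complex.add_re, Complex.one_re, Complex.ofReal_re, Complex.zero_re] at this
  linarith

theorem integrable_phiStieltjes {al : ℂ} (h1 : -(1 / 2) < al.re) (h2 : al.re < 1) {z : ℂ}
    (hz : -1 < z.re) :
    Integrable (fun t : ℝ => gaussPhi al (-(t : ℂ)) * (1 + (t : ℂ) + z)⁻¹) volPos := by
  obtain ⟨s, C, hs, hs1, hC0, hC⟩ := exists_decay_gaussPhi h1 h2
  exact integrable_mul_of_decay (by linarith : 0 < s) hC0
    (aestronglyMeasurable_gaussPhi_neg (by linarith) h2) hC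
    (Measurable.aestronglyMeasurable (by fun_prop))
    fun t ht => norm_inv_one_add_add_le (d := z.re + 1) (by linarith) (by linarith) ht.le

theorem differentiableOn_phiStieltjes {al : ℂ} (h1 : -(1 / 2) < al.re) (h2 : al.re < 1) :
    DifferentiableOn ℂ (phiStieltjes al) {z | -1 < z.re} := by
  intro z₀ hz₀
  refine DifferentiableAt.differentiableWithinAt ?_
  have hz₀' : -1 < z₀.re := hz₀
  obtain ⟨e, he, he'⟩ := exists_between hz₀'
  have hi := integrable_phiMoment h1 h2 0
  have hopen : ∀ b : ℝ, IsOpen {z : ℂ | b < z.re} := fun b =>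
    isOpen_lt continuous_const Complex.continuous_re
  have key := hasDerivAt_integral_of_dominated_loc_of_deriv_le (μ := volPos) (x₀ := z₀)
    (s := {z : ℂ | e < z.re})
    (F := fun z (t : ℝ) => gaussPhi al (-(t : ℂ)) * (1 + (t : ℂ) + z)⁻¹)
    (F' := fun z (t : ℝ) => gaussPhi al (-(t : ℂ)) * (-1 / (1 + (t : ℂ) + z) ^ 2))
    (bound := fun t : ℝ => ‖gaussPhi al (-(t : ℂ)) * ((1 + (t : ℂ)) ^ (0 + 1))⁻¹‖ *
      ((min 1 (e + 1))⁻¹) ^ 2)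
    ((hopen e).mem_nhds he') ?_ (integrable_phiStieltjes h1 h2 hz₀') ?_ ?_ (hi.norm.mul_const _) ?_
  · exact key.2.differentiableAt
  · filter_upwards [(hopen (-1)).mem_nhds hz₀'] with z hz
    exact (integrable_phiStieltjes h1 h2 hz).aestronglyMeasurable
  · exact (aestronglyMeasurable_gaussPhi_neg (by linarith) h2).mul
      (Measurable.aestronglyMeasurable (by fun_prop))
  · refine (ae_restrict_mem measurableSet_Ioi).mono fun t ht z hz => ?_
    have ht0 : (0 : ℝ) ≤ t := le_of_lt ht
    have hze : e < z.re := hz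
    have hm : 0 < min 1 (e + 1) := lt_min one_pos (by linarith)
    have h3 := norm_inv_one_add_add_le (d := e + 1) (by linarith) (by linarith : _ ≤ z.re) ht0
    rw [norm_mul, norm_mul, mul_assoc]
    refine mul_le_mul_of_nonneg_left ?_ (norm_nonneg _)
    rw [zero_add, pow_one, norm_inv, norm_one_add_ofReal ht0, neg_div, norm_neg, one_div,
      norm_inv, norm_pow, ← inv_pow, ← norm_inv]
    refine (pow_le_pow_left₀ (norm_nonneg _) h3 2).trans ?_
    rw [mul_pow, mul_comm]
    refine mul_le_mul_of_nonneg_right ?_ (by positivity)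
    rw [sq]
    exact mul_le_of_le_one_left (by positivity) (inv_le_one_of_one_le₀ (by linarith))
  · refine (ae_restrict_mem measurableSet_Ioi).mono fun t ht z hz => ?_
    have ht0 : (0 : ℝ) ≤ t := le_of_lt ht
    have hze : e < z.re := hz
    exact (((hasDerivAt_id' z).const_add _).fun_inv
      (one_add_add_ne_zero (by linarith) ht0)).const_mul _

theorem gaussPhi_add_phiStieltjes {al c : ℂ} {lam : ℂ} (h1 : -(1 / 2) < al.re) (h2 : al.re < 1)
    (hc : c ≠ 0) (hlam : c * (al * (1 - al)) = lam)
    (hlim : Filter.Tendsto (phiCoeff al) Filter.atTop (nhds c)) {z : ℂ} (hz : -1 < z.re) :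
    gaussPhi al (-z) + lam * phiStieltjes al z = c * (1 + z)⁻¹ := by
  have hopen : IsOpen {z : ℂ | -1 < z.re} := isOpen_lt continuous_const Complex.continuous_re
  have hconn : IsPreconnected {z : ℂ | -1 < z.re} := (convex_halfSpace_re_gt (-1)).isPreconnected
  have hd1 : DifferentiableOn ℂ (fun z => gaussPhi al (-z) + lam * phiStieltjes al z)
      {z | -1 < z.re} := by
    refine DifferentiableOn.add ?_ ((differentiableOn_phiStieltjes h1 h2).const_mul lam)
    exact (differentiableOn_gaussPhi (by linarith) h2).comp (by fun_prop)
      fun z hz => neg_mem_cutPlane hz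
  have hd2 : DifferentiableOn ℂ (fun z : ℂ => c * (1 + z)⁻¹) {z | -1 < z.re} := by
    refine DifferentiableOn.const_mul (DifferentiableOn.inv (by fun_prop) fun z hz => ?_) c
    simpa using one_add_add_ne_zero hz le_rfl
  refine AnalyticOnNhd.eqOn_of_preconnected_of_eventuallyEq (hd1.analyticOnNhd hopen)
    (hd2.analyticOnNhd hopen) hconn (z₀ := 0) (by simp) ?_ hz
  filter_upwards [Metric.ball_mem_nhds (0 : ℂ) one_pos] with w hw
  have hw' : ‖w‖ < 1 := by simpa using hw
  have hs1 := hasSum_gaussPhi (by linarith) h2 (z := -w) (by rwa [norm_neg])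
  have hs2 := (hasSum_phiStieltjes h1 h2 hw').mul_left lam
  have hs3 := (hasSum_geometric_of_norm_lt_one (ξ := -w) (by rwa [norm_neg])).mul_left c
  rw [sub_neg_eq_add] at hs3
  refine (hs1.add hs2).unique (hs3.congr_fun fun n => ?_)
  rw [← phiCoeff_add_phiMoment h1 h2 hc hlam hlim n]
  ring

/-! ### Hilbert's inequality and uniqueness in `L²` -/

instance : SFinite volPos := by
  unfold volPos
  infer_instance

/-- An antiderivative is `(2/√a) arctan √(t/a)`. It is only continuous at `0`, where the integrand
has an integrable singularity. -/
theorem integral_inv_sqrt_mul_inv_add {a : ℝ} (ha : 0 < a) :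
    IntegrableOn (fun t : ℝ => (√t)⁻¹ * (a + t)⁻¹) (Set.Ioi 0) ∧
      ∫ t in Set.Ioi (0 : ℝ), (√t)⁻¹ * (a + t)⁻¹ = Real.pi / √a := by
  have hsa : 0 < √a := Real.sqrt_pos.mpr ha
  have hcont : ContinuousWithinAt (fun t : ℝ => 2 / √a * Real.arctan (√t / √a)) (Set.Ici 0) 0 :=
    Continuous.continuousWithinAt
      ((Real.continuous_arctan.comp (Real.continuous_sqrt.div_const _)).const_mul _)
  have hderiv : ∀ t ∈ Set.Ioi (0 : ℝ), HasDerivAt (fun t : ℝ => 2 / √a * Real.arctan (√t / √a))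
      ((√t)⁻¹ * (a + t)⁻¹) t := by
    intro t ht
    have ht0 : (0 : ℝ) < t := ht
    have hst : 0 < √t := Real.sqrt_pos.mpr ht0
    have h := (((Real.hasDerivAt_sqrt ht0.ne').div_const (√a)).arctan).const_mul (2 / √a)
    refine h.congr_deriv ?_
    have h1 : (√a) ^ 2 = a := Real.sq_sqrt ha.le
    have h2 : (√t) ^ 2 = t := Real.sq_sqrt ht0.le
    have h3 : 0 < a + t := by linarith
    have h4 : 1 + (√t / √a) ^ 2 = (a + t) / a := by
      rw [div_pow, h1, h2]; field_simp
    rw [h4]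
    field_simp
    rw [h1]
  have hpos : ∀ t ∈ Set.Ioi (0 : ℝ), 0 ≤ (√t)⁻¹ * (a + t)⁻¹ := by
    intro t ht
    have ht0 : (0 : ℝ) < t := ht
    positivity
  have hlim : Filter.Tendsto (fun t : ℝ => 2 / √a * Real.arctan (√t / √a)) Filter.atTop
      (nhds (2 / √a * (Real.pi / 2))) := by
    refine Filter.Tendsto.const_mul _ ?_
    have h1 : Filter.Tendsto (fun t : ℝ => √t / √a) Filter.atTop Filter.atTop :=
      Real.tendsto_sqrt_atTop.atTop_div_const hsa
    exact (Real.tendsto_arctan_atTop.mono_right nhdsWithin_le_nhds).comp h1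
  refine ⟨integrableOn_Ioi_deriv_of_nonneg hcont hderiv hpos hlim, ?_⟩
  rw [integral_Ioi_of_hasDerivAt_of_nonneg hcont hderiv hpos hlim]
  simp

/-- Schur's test with weight `√(x/t)`: the inner integral is `π √(x/(m+x)) ≤ π`. -/
theorem hilbert_weight {m : ℝ} (hm : 0 < m) {g : ℝ → ℂ} (hg : MemLp g 2 volPos) :
    Integrable (fun p : ℝ × ℝ => ‖g p.1‖ ^ 2 * (√p.1 * ((√p.2)⁻¹ * (m + p.1 + p.2)⁻¹)))
      (volPos.prod volPos) ∧
    ∫ p : ℝ × ℝ, ‖g p.1‖ ^ 2 * (√p.1 * ((√p.2)⁻¹ * (m + p.1 + p.2)⁻¹)) ∂(volPos.prod volPos) ≤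
      Real.pi * ∫ x, ‖g x‖ ^ 2 ∂volPos := by
  have hg2 := (memLp_two_iff_integrable_sq_norm hg.1).mp hg
  have hmeas : AEStronglyMeasurable
      (fun p : ℝ × ℝ => ‖g p.1‖ ^ 2 * (√p.1 * ((√p.2)⁻¹ * (m + p.1 + p.2)⁻¹)))
      (volPos.prod volPos) :=
    (hg.1.norm.pow 2).comp_fst.mul (Measurable.aestronglyMeasurable (by fun_prop))
  have hin : ∀ x ∈ Set.Ioi (0 : ℝ),
      ∫ t, ‖g x‖ ^ 2 * (√x * ((√t)⁻¹ * (m + x + t)⁻¹)) ∂volPos =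
        ‖g x‖ ^ 2 * (√x * (Real.pi / √(m + x))) := by
    intro x hx
    have hx0 : (0 : ℝ) < x := hx
    rw [integral_const_mul, integral_const_mul]
    congr 2
    exact (integral_inv_sqrt_mul_inv_add (by linarith)).2
  have hle : ∀ x ∈ Set.Ioi (0 : ℝ),
      ‖g x‖ ^ 2 * (√x * (Real.pi / √(m + x))) ≤ Real.pi * ‖g x‖ ^ 2 := by
    intro x hx
    have hx0 : (0 : ℝ) < x := hx
    have hmx : 0 < √(m + x) := Real.sqrt_pos.mpr (by linarith)
    rw [mul_comm Real.pi]
    refine mul_le_mul_of_nonneg_left ?_ (by positivity)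
    rw [mul_div_left_comm]
    refine mul_le_of_le_one_right Real.pi_pos.le ((div_le_one hmx).mpr ?_)
    exact Real.sqrt_le_sqrt (by linarith)
  have hmeas2 : AEStronglyMeasurable (fun x => ‖g x‖ ^ 2 * (√x * (Real.pi / √(m + x)))) volPos :=
    (hg.1.norm.pow 2).mul (Measurable.aestronglyMeasurable (by fun_prop))
  have hint2 : Integrable (fun x => ‖g x‖ ^ 2 * (√x * (Real.pi / √(m + x)))) volPos := by
    refine (hg2.const_mul Real.pi).mono' hmeas2 ((ae_restrict_mem measurableSet_Ioi).mono
      fun x hx => ?_)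
    rw [Real.norm_of_nonneg (by have := Real.pi_pos; positivity)]
    exact hle x hx
  have hint : Integrable
      (fun p : ℝ × ℝ => ‖g p.1‖ ^ 2 * (√p.1 * ((√p.2)⁻¹ * (m + p.1 + p.2)⁻¹)))
      (volPos.prod volPos) := by
    refine (integrable_prod_iff hmeas).mpr ⟨?_, ?_⟩
    · refine (ae_restrict_mem measurableSet_Ioi).mono fun x hx => ?_
      have hx0 : (0 : ℝ) < x := hx
      have hmx : 0 < m + x := by linarith
      exact ((integral_inv_sqrt_mul_inv_add hmx).1.const_mul (√x)).const_mul (‖g x‖ ^ 2)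
    · refine hint2.congr ((ae_restrict_mem measurableSet_Ioi).mono fun x hx => ?_)
      have hx0 : (0 : ℝ) < x := hx
      simp only
      rw [← hin x hx]
      refine integral_congr_ae ((ae_restrict_mem measurableSet_Ioi).mono fun t ht => ?_)
      have ht0 : (0 : ℝ) < t := ht
      simp only
      rw [Real.norm_of_nonneg (by positivity)]
  refine ⟨hint, ?_⟩
  rw [integral_prod _ hint, ← integral_const_mul]
  refine integral_mono_ae hint.integral_prod_left (hg2.const_mul _)
    ((ae_restrict_mem measurableSet_Ioi).mono fun x hx => ?_)
  simp only
  rw [hin x hx]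
  exact hle x hx

theorem ae_prod_volPos {P : ℝ × ℝ → Prop} (h : ∀ p : ℝ × ℝ, 0 < p.1 → 0 < p.2 → P p) :
    ∀ᵐ p ∂(volPos.prod volPos), P p := by
  have : volPos.prod volPos = (volume.prod volume).restrict (Set.Ioi (0 : ℝ) ×ˢ Set.Ioi (0 : ℝ)) :=
    Measure.prod_restrict _ _
  rw [this]
  exact (ae_restrict_mem (measurableSet_Ioi.prod measurableSet_Ioi)).mono fun p hp => h p hp.1 hp.2

/-- Hilbert's inequality with the shifted kernel `1 / (m + x + t)`. -/
theorem hilbert_inequality {m : ℝ} (hm : 0 < m) {g : ℝ → ℂ} (hg : MemLp g 2 volPos) :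
    Integrable (fun p : ℝ × ℝ => (starRingEnd ℂ) (g p.1) * (g p.2 * ((m + p.1 + p.2 : ℝ) : ℂ)⁻¹))
      (volPos.prod volPos) ∧
    ‖∫ p : ℝ × ℝ, (starRingEnd ℂ) (g p.1) * (g p.2 * ((m + p.1 + p.2 : ℝ) : ℂ)⁻¹)
      ∂(volPos.prod volPos)‖ ≤ Real.pi * ∫ x, ‖g x‖ ^ 2 ∂volPos := by
  obtain ⟨hi, hle⟩ := hilbert_weight hm hg
  have hi' := hi.swap
  have hle' := hle
  rw [← integral_prod_swap] at hle'
  have hmeas : AEStronglyMeasurable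
      (fun p : ℝ × ℝ => (starRingEnd ℂ) (g p.1) * (g p.2 * ((m + p.1 + p.2 : ℝ) : ℂ)⁻¹))
      (volPos.prod volPos) := by
    refine AEStronglyMeasurable.mul (Complex.continuous_conj.comp_aestronglyMeasurable
      hg.1.comp_fst) (hg.1.comp_snd.mul (Measurable.aestronglyMeasurable (by fun_prop)))
  have hb : ∀ᵐ p : ℝ × ℝ ∂(volPos.prod volPos),
      ‖(starRingEnd ℂ) (g p.1) * (g p.2 * ((m + p.1 + p.2 : ℝ) : ℂ)⁻¹)‖ ≤
      2⁻¹ * (‖g p.1‖ ^ 2 * (√p.1 * ((√p.2)⁻¹ * (m + p.1 + p.2)⁻¹)) +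
        ‖g p.2‖ ^ 2 * (√p.2 * ((√p.1)⁻¹ * (m + p.2 + p.1)⁻¹))) := by
    refine ae_prod_volPos fun p hx ht => ?_
    have hsx := Real.sqrt_pos.mpr hx
    have hst := Real.sqrt_pos.mpr ht
    have hk : 0 < m + p.1 + p.2 := by linarith
    rw [norm_mul, norm_mul, norm_inv, Complex.norm_real, Real.norm_of_nonneg hk.le,
      RCLike.norm_conj, show m + p.2 + p.1 = m + p.1 + p.2 by ring]
    -- The arithmetic-geometric mean inequality with weights `√(x/t)` and `√(t/x)`, its gap written
    -- as a square. The two terms of the bound are exchanged by the swap of variables.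
    have h1 : 2⁻¹ * (‖g p.1‖ ^ 2 * (√p.1 * ((√p.2)⁻¹ * (m + p.1 + p.2)⁻¹)) +
        ‖g p.2‖ ^ 2 * (√p.2 * ((√p.1)⁻¹ * (m + p.1 + p.2)⁻¹))) -
        ‖g p.1‖ * (‖g p.2‖ * (m + p.1 + p.2)⁻¹) =
        2⁻¹ * (√p.1 * √p.2)⁻¹ * (m + p.1 + p.2)⁻¹ * (‖g p.1‖ * √p.1 - ‖g p.2‖ * √p.2) ^ 2 := by
      field_simp
      ring
    have h2 : 0 ≤ 2⁻¹ * (√p.1 * √p.2)⁻¹ * (m + p.1 + p.2)⁻¹ *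
        (‖g p.1‖ * √p.1 - ‖g p.2‖ * √p.2) ^ 2 := by positivity
    linarith
  have hbi := (hi.add hi').const_mul 2⁻¹
  refine ⟨hbi.mono' hmeas hb, (norm_integral_le_of_norm_le hbi hb).trans ?_⟩
  rw [integral_const_mul]
  have hadd := integral_add hi hi'
  simp only [Pi.add_apply, Function.comp_apply, Prod.fst_swap, Prod.snd_swap] at hadd hle' ⊢
  rw [hadd]
  linarith

theorem integral_exp_neg_mul_add {a : ℝ} (ha : 0 < a) :
    IntegrableOn (fun s : ℝ => Real.exp (-a * s)) (Set.Ioi 0) ∧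
      ∫ s in Set.Ioi (0 : ℝ), Real.exp (-a * s) = a⁻¹ := by
  refine ⟨integrableOn_exp_mul_Ioi (by linarith) 0, ?_⟩
  rw [integral_exp_mul_Ioi (by linarith) 0]
  simp

/-- Positivity of the kernel `1 / (m + x + t)`, by Laplace transform. -/
theorem hilbert_form_nonneg {m : ℝ} (hm : 0 < m) {g : ℝ → ℂ} (hg : MemLp g 2 volPos) :
    ∃ q : ℝ, 0 ≤ q ∧
      ∫ p : ℝ × ℝ, (starRingEnd ℂ) (g p.1) * (g p.2 * ((m + p.1 + p.2 : ℝ) : ℂ)⁻¹)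
        ∂(volPos.prod volPos) = q := by
  obtain ⟨hi, -⟩ := hilbert_inequality hm hg
  set F : (ℝ × ℝ) → ℝ → ℂ := fun p s => (starRingEnd ℂ) (g p.1) * g p.2 *
    (Real.exp (-(m + p.1 + p.2) * s) : ℂ) with hF
  have hmeas : AEStronglyMeasurable (Function.uncurry F) ((volPos.prod volPos).prod volPos) := by
    have h1 : AEStronglyMeasurable (fun p : ℝ × ℝ => (starRingEnd ℂ) (g p.1) * g p.2)
        (volPos.prod volPos) :=
      (Complex.continuous_conj.comp_aestronglyMeasurable hg.1.comp_fst).mul hg.1.comp_snd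
    exact h1.comp_fst.mul (Measurable.aestronglyMeasurable (by fun_prop))
  -- Integrating the absolute value in `s` restores `|g(x) g(t)|/(m+x+t)`, so Fubini's hypothesis is
  -- Hilbert's inequality.
  have hint : Integrable (Function.uncurry F) ((volPos.prod volPos).prod volPos) := by
    refine (integrable_prod_iff hmeas).mpr ⟨ae_prod_volPos fun p hx ht => ?_, ?_⟩
    · have hk : 0 < m + p.1 + p.2 := by linarith
      exact ((integral_exp_neg_mul_add hk).1.ofReal (𝕜 := ℂ)).const_mul
        ((starRingEnd ℂ) (g p.1) * g p.2)
    · refine hi.norm.congr (ae_prod_volPos fun p hx ht => ?_)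
      have hk : 0 < m + p.1 + p.2 := by linarith
      simp only [hF, Function.uncurry, norm_mul, Complex.norm_real, norm_inv,
        Real.norm_of_nonneg (Real.exp_pos _).le]
      rw [integral_const_mul, Real.norm_of_nonneg hk.le, mul_assoc]
      congr 2
      exact (integral_exp_neg_mul_add hk).2.symm
  have hswap := integral_integral_swap hint
  have hleft : ∫ p, (∫ s, F p s ∂volPos) ∂(volPos.prod volPos) =
      ∫ p : ℝ × ℝ, (starRingEnd ℂ) (g p.1) * (g p.2 * ((m + p.1 + p.2 : ℝ) : ℂ)⁻¹)
        ∂(volPos.prod volPos) := by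
    refine integral_congr_ae (ae_prod_volPos fun p hx ht => ?_)
    have hk : 0 < m + p.1 + p.2 := by linarith
    simp only [hF]
    rw [integral_const_mul, integral_complex_ofReal, mul_assoc]
    congr 2
    rw [← Complex.ofReal_inv]
    congr 1
    exact (integral_exp_neg_mul_add hk).2
  -- For fixed `s` the exponential factorises and the double integral becomes `e^(-ms)` times the
  -- squared modulus of the Laplace transform of `g` at `s`.
  have hright : ∀ s : ℝ, ∫ p, F p s ∂(volPos.prod volPos) =
      ((Real.exp (-m * s) * ‖∫ t, g t * (Real.exp (-s * t) : ℂ) ∂volPos‖ ^ 2 : ℝ) : ℂ) := by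
    intro s
    have h1 : ∀ p : ℝ × ℝ, F p s = (Real.exp (-m * s) : ℂ) *
        ((starRingEnd ℂ) (g p.1 * (Real.exp (-s * p.1) : ℂ)) *
          (g p.2 * (Real.exp (-s * p.2) : ℂ))) := by
      intro p
      have : Real.exp (-(m + p.1 + p.2) * s) =
          Real.exp (-m * s) * (Real.exp (-s * p.1) * Real.exp (-s * p.2)) := by
        rw [← Real.exp_add, ← Real.exp_add]
        congr 1
        ring
      simp only [hF, this, map_mul, Complex.conj_ofReal]
      push_cast
      ring
    simp_rw [h1]
    rw [integral_const_mul, integral_prod_mul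
      (f := fun x => (starRingEnd ℂ) (g x * (Real.exp (-s * x) : ℂ)))
      (g := fun t => g t * (Real.exp (-s * t) : ℂ)), integral_conj, Complex.conj_mul']
    push_cast
    ring
  refine ⟨∫ s, Real.exp (-m * s) * ‖∫ t, g t * (Real.exp (-s * t) : ℂ) ∂volPos‖ ^ 2 ∂volPos,
    integral_nonneg fun s => by positivity, ?_⟩
  rw [← hleft, hswap, ← integral_complex_ofReal]
  exact integral_congr_ae (Filter.Eventually.of_forall hright)

/-- For `λ > -1/π` the homogeneous equation has no nonzero solution in `L²`. -/
theorem eq_zero_of_homogeneous {lam m : ℝ} (hlam : -(1 / Real.pi) < lam) (hm : 0 < m) {w : ℝ → ℝ}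
    (hw : Measurable w) (hw0 : ∀ x, 0 < x → 0 ≤ w x) (hw1 : ∀ x, 0 < x → w x ≤ 1) {r : ℝ → ℂ}
    (hr : MemLp r 2 volPos)
    (heq : ∀ᵐ x ∂volPos, r x =
      -(lam : ℂ) * (w x * ∫ t, w t * r t * ((m + x + t : ℝ) : ℂ)⁻¹ ∂volPos)) :
    ∀ᵐ x ∂volPos, r x = 0 := by
  have hle : ∀ᵐ x ∂volPos, ‖(w x : ℂ) * r x‖ ≤ ‖r x‖ := by
    refine (ae_restrict_mem measurableSet_Ioi).mono fun x hx => ?_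
    rw [norm_mul, Complex.norm_real, Real.norm_of_nonneg (hw0 x hx)]
    exact mul_le_of_le_one_left (norm_nonneg _) (hw1 x hx)
  have hg : MemLp (fun x => (w x : ℂ) * r x) 2 volPos :=
    hr.mono ((Complex.measurable_ofReal.comp hw).aestronglyMeasurable.mul hr.1) hle
  have hr2 := (memLp_two_iff_integrable_sq_norm hr.1).mp hr
  have hg2 := (memLp_two_iff_integrable_sq_norm hg.1).mp hg
  obtain ⟨hi, hb⟩ := hilbert_inequality hm hg
  obtain ⟨q, hq0, hq⟩ := hilbert_form_nonneg hm hg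
  rw [hq, Complex.norm_real, Real.norm_of_nonneg hq0] at hb
  set N := ∫ x, ‖r x‖ ^ 2 ∂volPos with hN
  have hN0 : 0 ≤ N := integral_nonneg fun x => by positivity
  have hgN : ∫ x, ‖(w x : ℂ) * r x‖ ^ 2 ∂volPos ≤ N :=
    integral_mono_ae hg2 hr2 (hle.mono fun x hx => pow_le_pow_left₀ (norm_nonneg _) hx 2)
  -- The equation is paired with `r`; the two weights turn the right side into the quadratic form of
  -- `w r`.
  have hNq : N = -lam * q := by
    have h1 : (N : ℂ) = -(lam : ℂ) * q := by
      rw [← hq, integral_prod _ hi, ← integral_const_mul, hN, ← integral_complex_ofReal]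
      refine integral_congr_ae (heq.mono fun x hx => ?_)
      simp only
      rw [integral_const_mul, map_mul, Complex.conj_ofReal]
      have h2 : ((‖r x‖ ^ 2 : ℝ) : ℂ) = (starRingEnd ℂ) (r x) * r x := by
        rw [Complex.conj_mul']
        push_cast
        rfl
      rw [h2]
      nth_rewrite 2 [hx]
      ring
    exact_mod_cast h1
  have hpi := Real.pi_pos
  have hlp : 0 < 1 + lam * Real.pi := by
    have := mul_lt_mul_of_pos_right hlam hpi
    rw [neg_mul, one_div, inv_mul_cancel₀ hpi.ne'] at this
    linarith
  -- For `λ ≥ 0` positivity gives `N = -λ q ≤ 0`. For `λ < 0` Hilbert's bound gives `N ≤ -λ π N`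
  -- with `-λ π < 1`.
  have hN00 : N = 0 := by
    have hqN : q ≤ Real.pi * N := hb.trans (mul_le_mul_of_nonneg_left hgN hpi.le)
    rcases le_total 0 lam with h | h
    · nlinarith
    · nlinarith
  have h3 := (integral_eq_zero_iff_of_nonneg (fun x => by positivity) hr2).mp hN00
  exact h3.mono fun x hx => by simpa using hx

/-! ### The parameters -/

theorem alphaParam_of_le {lam : ℝ} (h : lam ≤ 1 / Real.pi) :
    alphaParam lam = ((Real.arcsin (lam * Real.pi) / Real.pi : ℝ) : ℂ) := by
  rw [alphaParam, if_pos h]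

theorem neg_one_lt_mul_pi {lam : ℝ} (hlam : -(1 / Real.pi) < lam) : -1 < lam * Real.pi := by
  have := mul_lt_mul_of_pos_right hlam Real.pi_pos
  rwa [neg_mul, one_div, inv_mul_cancel₀ Real.pi_ne_zero] at this

theorem sin_alphaParam {lam : ℝ} (hlam : -(1 / Real.pi) < lam) :
    Complex.sin (alphaParam lam * (Real.pi : ℂ)) = ((lam * Real.pi : ℝ) : ℂ) := by
  have hpi : (Real.pi : ℂ) ≠ 0 := by exact_mod_cast Real.pi_ne_zero
  rcases le_total lam (1 / Real.pi) with h | h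
  · rw [alphaParam_of_le h, ← Complex.ofReal_mul, div_mul_cancel₀ _ Real.pi_ne_zero,
      ← Complex.ofReal_sin, Real.sin_arcsin (neg_one_lt_mul_pi hlam).le
        ((le_div_iff₀ Real.pi_pos).mp h)]
  · have h1 : (1 / 2 + Complex.I * ((Real.arcosh (lam * Real.pi) / Real.pi : ℝ) : ℂ)) * Real.pi =
        (Real.arcosh (lam * Real.pi) : ℂ) * Complex.I + Real.pi / 2 := by
      push_cast
      field_simp
      ring
    rw [alphaParam_of_ge h, h1, Complex.sin_add_pi_div_two, Complex.cos_mul_I,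
      ← Complex.ofReal_cosh, Real.cosh_arcosh ((div_le_iff₀ Real.pi_pos).mp h)]

theorem neg_half_lt_re_alphaParam {lam : ℝ} (hlam : -(1 / Real.pi) < lam) :
    -(1 / 2) < (alphaParam lam).re := by
  rcases le_total lam (1 / Real.pi) with h | h
  · rw [alphaParam_of_le h, Complex.ofReal_re, lt_div_iff₀ Real.pi_pos]
    have := Real.neg_pi_div_two_lt_arcsin.mpr (neg_one_lt_mul_pi hlam)
    linarith
  · rw [alphaParam_of_ge h]
    simp

theorem re_alphaParam_le (lam : ℝ) : (alphaParam lam).re ≤ 1 / 2 := by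
  rcases le_total lam (1 / Real.pi) with h | h
  · rw [alphaParam_of_le h, Complex.ofReal_re, div_le_iff₀ Real.pi_pos]
    have := Real.arcsin_le_pi_div_two (lam * Real.pi)
    linarith
  · rw [alphaParam_of_ge h]
    simp

theorem re_alphaParam_lt_one (lam : ℝ) : (alphaParam lam).re < 1 :=
  (re_alphaParam_le lam).trans_lt (by norm_num)

theorem alphaParam_ne_one (lam : ℝ) : alphaParam lam ≠ 1 := by
  intro h
  have := re_alphaParam_lt_one lam
  rw [h, Complex.one_re] at this
  exact lt_irrefl _ this

theorem alphaParam_ne_zero {lam : ℝ} (hlam : -(1 / Real.pi) < lam) (h0 : lam ≠ 0) :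
    alphaParam lam ≠ 0 := by
  intro h
  have := sin_alphaParam hlam
  rw [h, zero_mul, Complex.sin_zero] at this
  exact mul_ne_zero h0 Real.pi_ne_zero (by exact_mod_cast this.symm)

theorem alphaParam_zero : alphaParam 0 = 0 := by
  rw [alphaParam_of_le (by have := Real.pi_pos; positivity)]
  simp

/-- Either `α` is real, or `Re α = 1/2` and `1 - α` is its conjugate. -/
theorem alphaParam_mul_one_sub_im (lam : ℝ) :
    (alphaParam lam * (1 - alphaParam lam)).im = 0 := by
  rcases le_total lam (1 / Real.pi) with h | h
  · rw [alphaParam_of_le h]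
    simp
  · rw [alphaParam_of_ge h]
    simp
    ring

theorem cParam_mul {lam : ℝ} (hlam : -(1 / Real.pi) < lam) :
    cParam lam * (alphaParam lam * (1 - alphaParam lam)) = lam := by
  by_cases h : lam = 0
  · subst h
    simp [alphaParam_zero]
  · rw [cParam, if_neg h, div_mul_cancel₀]
    exact mul_ne_zero (alphaParam_ne_zero hlam h) (sub_ne_zero.mpr (alphaParam_ne_one lam).symm)

theorem cParam_ne_zero {lam : ℝ} (hlam : -(1 / Real.pi) < lam) : cParam lam ≠ 0 := by
  by_cases h : lam = 0
  · simp [cParam, h]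
  · intro h'
    have := cParam_mul hlam
    rw [h', zero_mul] at this
    exact h (by exact_mod_cast this.symm)

theorem cParam_im (lam : ℝ) : (cParam lam).im = 0 := by
  by_cases h : lam = 0
  · simp [cParam, h]
  · have h1 : alphaParam lam * (1 - alphaParam lam) =
        ((alphaParam lam * (1 - alphaParam lam)).re : ℂ) :=
      Complex.ext (by simp) (by rw [alphaParam_mul_one_sub_im, Complex.ofReal_im])
    rw [cParam, if_neg h, h1, ← Complex.ofReal_div, Complex.ofReal_im]

theorem tendsto_phiCoeff_cParam {lam : ℝ} (hlam : -(1 / Real.pi) < lam) :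
    Filter.Tendsto (phiCoeff (alphaParam lam)) Filter.atTop (nhds (cParam lam)) := by
  -- At `λ = 0` the limit formula would divide by `α = 0`, but there every coefficient is `1`.
  by_cases h : lam = 0
  · subst h
    have h1 : ∀ n, phiCoeff (alphaParam 0) n = 1 := by
      intro n
      rw [phiCoeff_eq_prod (alphaParam_ne_one 0), alphaParam_zero]
      have h2 : (n : ℂ) + 1 ≠ 0 := by exact_mod_cast n.succ_ne_zero
      simp [h2]
    simp only [cParam, if_true]
    exact tendsto_const_nhds.congr fun n => (h1 n).symm
  · have hpi : (Real.pi : ℂ) ≠ 0 := by exact_mod_cast Real.pi_ne_zero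
    have := tendsto_phiCoeff (alphaParam_ne_zero hlam h) (alphaParam_ne_one lam)
    rw [cParam, if_neg h]
    rwa [sin_alphaParam hlam, Complex.ofReal_mul, mul_div_cancel_right₀ _ hpi] at this

/-! ### Existence -/

theorem solPhi_eq (lam x : ℝ) : solPhi lam x = gaussPhi (alphaParam lam) (-(x : ℂ)) := by
  rw [solPhi, gaussPhi, Complex.ofReal_neg]

theorem exists_decay_solPhi {lam : ℝ} (hlam : -(1 / Real.pi) < lam) :
    ∃ s C : ℝ, 1 / 2 < s ∧ 0 ≤ C ∧ ∀ x : ℝ, 0 ≤ x → ‖solPhi lam x‖ ≤ C * (1 + x) ^ (-s) := by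
  obtain ⟨s, C, hs, -, hC0, hC⟩ :=
    exists_decay_gaussPhi (neg_half_lt_re_alphaParam hlam) (re_alphaParam_lt_one lam)
  exact ⟨s, C, hs, hC0, fun x hx => by rw [solPhi_eq]; exact hC x hx⟩

theorem continuousOn_solPhi {lam : ℝ} (hlam : -(1 / Real.pi) < lam) :
    ContinuousOn (solPhi lam) (Set.Ioi (-1)) :=
  (continuousOn_gaussPhi_neg (by linarith [neg_half_lt_re_alphaParam hlam])
    (re_alphaParam_lt_one lam)).congr fun x _ => solPhi_eq lam x

theorem memLp_solPhi {lam : ℝ} (hlam : -(1 / Real.pi) < lam) : MemLp (solPhi lam) 2 volPos := by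
  obtain ⟨s, C, hs, hC0, hC⟩ := exists_decay_solPhi hlam
  exact memLp_two_of_decay hs (((continuousOn_solPhi hlam).mono
    (Set.Ioi_subset_Ioi (by norm_num))).aestronglyMeasurable measurableSet_Ioi) hC

theorem rescaledIntegrand_eq (phi : ℝ → ℂ) (x t : ℝ) :
    rescaledIntegrand phi x t = phi t * (1 + (t : ℂ) + (x : ℂ))⁻¹ := by
  rw [rescaledIntegrand, div_eq_mul_inv]
  push_cast
  rfl

theorem integral_rescaledIntegrand_solPhi (lam x : ℝ) :
    ∫ t, rescaledIntegrand (solPhi lam) x t ∂volPos = phiStieltjes (alphaParam lam) x := by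
  simp_rw [rescaledIntegrand_eq, solPhi_eq]
  rfl

theorem solPhi_equation {lam : ℝ} (hlam : -(1 / Real.pi) < lam) {x : ℝ} (hx : 0 ≤ x) :
    solPhi lam x = cParam lam * (1 + (x : ℂ))⁻¹ - lam * phiStieltjes (alphaParam lam) x := by
  rw [solPhi_eq, eq_sub_iff_add_eq]
  exact gaussPhi_add_phiStieltjes (neg_half_lt_re_alphaParam hlam) (re_alphaParam_lt_one lam)
    (cParam_ne_zero hlam) (cParam_mul hlam) (tendsto_phiCoeff_cParam hlam)
    (by rw [Complex.ofReal_re]; linarith)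

theorem solPhi_zero {lam : ℝ} (hlam : -(1 / Real.pi) < lam) : solPhi lam 0 = 1 := by
  rw [solPhi_eq, Complex.ofReal_zero, neg_zero]
  exact gaussPhi_zero (by linarith [neg_half_lt_re_alphaParam hlam]) (re_alphaParam_lt_one lam)

theorem solvesRescaled_solPhi {lam : ℝ} (hlam : -(1 / Real.pi) < lam) :
    SolvesRescaled lam (cParam lam) (solPhi lam) := by
  refine ⟨fun x hx => ⟨?_, ?_⟩, solPhi_zero hlam⟩
  · refine (integrable_phiStieltjes (neg_half_lt_re_alphaParam hlam) (re_alphaParam_lt_one lam)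
      (z := (x : ℂ)) (by rw [Complex.ofReal_re]; linarith)).congr
      (Filter.Eventually.of_forall fun t => ?_)
    rw [rescaledIntegrand_eq, solPhi_eq]
  · rw [rescaledRHS, integral_rescaledIntegrand_solPhi, solPhi_equation hlam hx, div_eq_mul_inv]
    push_cast
    rfl

theorem solJ_eq {lam mu : ℝ} (hlam : -(1 / Real.pi) < lam) {x : ℝ} (hx : 0 ≤ x) :
    solJ lam mu x = ((x * (1 + x / mu ^ 2) : ℝ) : ℂ) * solPhi lam (x / mu ^ 2) := by
  have h1 : ((-(x / mu ^ 2) : ℝ) : ℂ) ∈ cutPlane := by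
    rw [Complex.ofReal_neg]
    refine neg_mem_cutPlane ?_
    rw [Complex.ofReal_re]
    have : 0 ≤ x / mu ^ 2 := by positivity
    linarith
  have h2 := (isGaussContinuation_one_sub_mul_gaussPhi
    (by linarith [neg_half_lt_re_alphaParam hlam]) (re_alphaParam_lt_one lam)).eqOn_hyp2F1 h1
  rw [solJ, ← h2, solPhi, gaussPhi]
  push_cast
  ring

theorem symmetrised_solJ {lam mu : ℝ} (hlam : -(1 / Real.pi) < lam) (hmu : 0 < mu) {x : ℝ}
    (hx : 0 < x) :
    symmetrised mu (solJ lam mu) x = ((mu ^ 2 : ℝ) : ℂ)⁻¹ * solPhi lam (x / mu ^ 2) := by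
  have h1 : x * (1 + x / mu ^ 2) / (x * (mu ^ 2 + x)) = (mu ^ 2)⁻¹ := by
    have : mu ^ 2 + x ≠ 0 := by positivity
    field_simp
  rw [symmetrised, solJ_eq hlam hx.le, ← Complex.ofReal_inv, ← h1, Complex.ofReal_div]
  ring

theorem memLp_symmetrised_solJ {lam mu : ℝ} (hlam : -(1 / Real.pi) < lam) (hmu : 0 < mu) :
    MemLp (symmetrised mu (solJ lam mu)) 2 volPos := by
  obtain ⟨s, C, hs, hC0, hC⟩ := exists_decay_solPhi hlam
  have hm : 0 < mu ^ 2 := by positivity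
  have hmin : 0 < min 1 (mu ^ 2)⁻¹ := lt_min one_pos (by positivity)
  have hmeas : AEStronglyMeasurable (fun x : ℝ => solPhi lam (x / mu ^ 2)) volPos := by
    refine ContinuousOn.aestronglyMeasurable ?_ measurableSet_Ioi
    refine (continuousOn_solPhi hlam).comp (by fun_prop) fun x hx => ?_
    have hx0 : (0 : ℝ) < x := hx
    have : 0 < x / mu ^ 2 := by positivity
    exact Set.mem_Ioi.mpr (by linarith)
  have h1 : MemLp (fun x : ℝ => solPhi lam (x / mu ^ 2)) 2 volPos := by
    refine memLp_two_of_decay (C := C * (min 1 (mu ^ 2)⁻¹) ^ (-s)) hs hmeas fun x hx => ?_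
    refine (hC _ (by positivity)).trans ?_
    rw [mul_assoc, ← Real.mul_rpow hmin.le (by linarith)]
    refine mul_le_mul_of_nonneg_left ?_ hC0
    refine Real.rpow_le_rpow_of_nonpos (by positivity) ?_ (by linarith)
    have h2 := min_le_left 1 (mu ^ 2)⁻¹
    have h3 := mul_le_mul_of_nonneg_right (min_le_right 1 (mu ^ 2)⁻¹) hx
    rw [div_eq_inv_mul]
    linarith
  refine (h1.const_mul (((mu ^ 2 : ℝ) : ℂ)⁻¹)).ae_eq
    ((ae_restrict_mem measurableSet_Ioi).mono fun x hx => ?_)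
  exact (symmetrised_solJ hlam hmu hx).symm

/-! ### The two equations in `L²` -/

/-- Cauchy–Schwarz, as `1/(a+t)` is square-integrable on the half-line. -/
theorem integrable_mul_inv_add {f : ℝ → ℂ} (hf : MemLp f 2 volPos) {a : ℝ} (ha : 0 < a) :
    Integrable (fun t : ℝ => f t * ((a + t : ℝ) : ℂ)⁻¹) volPos := by
  have hk : MemLp (fun t : ℝ => ((a + t : ℝ) : ℂ)⁻¹) 2 volPos := by
    refine memLp_two_of_decay (C := (min 1 a)⁻¹) (s := 1) (by norm_num)
      (Measurable.aestronglyMeasurable (by fun_prop)) fun t ht => ?_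
    have h := norm_inv_one_add_add_le (z := ((a - 1 : ℝ) : ℂ)) ha
      (by rw [Complex.ofReal_re]; linarith) ht
    rw [Real.rpow_neg_one]
    convert h using 3
    push_cast
    ring
  exact hf.integrable_mul hk

theorem integrable_rescaledIntegrand {psi : ℝ → ℂ} (hpsi : MemLp psi 2 volPos) {x : ℝ}
    (hx : 0 < 1 + x) : Integrable (rescaledIntegrand psi x) volPos := by
  refine (integrable_mul_inv_add hpsi hx).congr (Filter.Eventually.of_forall fun t => ?_)
  simp only [rescaledIntegrand, div_eq_mul_inv]
  rw [add_right_comm]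

theorem rescaled_unique {lam : ℝ} (hlam : -(1 / Real.pi) < lam) {c : ℂ} {f g : ℝ → ℂ}
    (hf : MemLp f 2 volPos) (hg : MemLp g 2 volPos)
    (hfe : ∀ᵐ x ∂volPos, f x = rescaledRHS lam c f x)
    (hge : ∀ᵐ x ∂volPos, g x = rescaledRHS lam c g x) :
    ∀ᵐ x ∂volPos, f x = g x := by
  have h := eq_zero_of_homogeneous hlam one_pos (w := fun _ => 1) measurable_const
    (fun _ _ => zero_le_one) (fun _ _ => le_rfl) (hf.sub hg) ?_
  · exact h.mono fun x hx => sub_eq_zero.mp hx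
  · filter_upwards [hfe, hge, ae_restrict_mem measurableSet_Ioi] with x hxf hxg hx
    have hx0 : (0 : ℝ) < x := hx
    have h1x : 0 < 1 + x := by linarith
    rw [Pi.sub_apply, hxf, hxg, rescaledRHS, rescaledRHS, sub_sub_sub_cancel_left, ← mul_sub,
      ← integral_sub (integrable_rescaledIntegrand hg h1x) (integrable_rescaledIntegrand hf h1x),
      Complex.ofReal_one, one_mul, neg_mul, ← mul_neg, ← integral_neg]
    congr 2
    ext t
    simp only [rescaledIntegrand, Pi.sub_apply, one_mul, div_eq_mul_inv]
    rw [add_right_comm 1 x t]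
    ring

/-- The weight `x / (μ² + x)` of the symmetrised Fredholm kernel. -/
def fredWeight (mu x : ℝ) : ℝ := x / (mu ^ 2 + x)

theorem measurable_fredWeight (mu : ℝ) : Measurable (fredWeight mu) :=
  measurable_id.div (measurable_const.add measurable_id)

theorem fredWeight_nonneg (mu : ℝ) {x : ℝ} (hx : 0 < x) : 0 ≤ fredWeight mu x := by
  unfold fredWeight
  positivity

theorem fredWeight_le_one (mu : ℝ) {x : ℝ} (hx : 0 < x) : fredWeight mu x ≤ 1 := by
  unfold fredWeight
  exact (div_le_one (by positivity)).mpr (by linarith [sq_nonneg mu])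

theorem memLp_fredWeight_mul (mu : ℝ) {f : ℝ → ℂ} (hf : MemLp f 2 volPos) :
    MemLp (fun t => (fredWeight mu t : ℂ) * f t) 2 volPos := by
  refine hf.mono ((Complex.measurable_ofReal.comp
    (measurable_fredWeight mu)).aestronglyMeasurable.mul hf.1)
    ((ae_restrict_mem measurableSet_Ioi).mono fun t ht => ?_)
  rw [norm_mul, Complex.norm_real, Real.norm_of_nonneg (fredWeight_nonneg mu ht)]
  exact mul_le_of_le_one_left (norm_nonneg _) (fredWeight_le_one mu ht)

/-- One factor `1/(t+μ²)²` is split as `w(t) · 1/(t(μ²+t))`, which exposes the symmetric kernel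
`w(x) w(t)/(μ²+x+t)`. -/
theorem fredIntegrand_eq (mu : ℝ) (K : ℝ → ℂ) (x : ℝ) {t : ℝ} (ht : 0 < t) :
    fredIntegrand mu K x t =
      (fredWeight mu t : ℂ) * symmetrised mu K t * ((mu ^ 2 + x + t : ℝ) : ℂ)⁻¹ := by
  have h1 : fredWeight mu t * (t * (mu ^ 2 + t))⁻¹ = ((t + mu ^ 2) ^ 2)⁻¹ := by
    have : mu ^ 2 + t ≠ 0 := by positivity
    have : t + mu ^ 2 ≠ 0 := by positivity
    unfold fredWeight
    field_simp
    ring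
  have h2 : t + mu ^ 2 + x = mu ^ 2 + x + t := by ring
  rw [fredIntegrand, symmetrised, h2, Complex.ofReal_mul, div_eq_mul_inv, mul_inv,
    ← Complex.ofReal_inv ((t + mu ^ 2) ^ 2), ← h1]
  push_cast
  ring

theorem integrable_fredIntegrand {mu : ℝ} (hmu : 0 < mu) {K : ℝ → ℂ}
    (hK : MemLp (symmetrised mu K) 2 volPos) {x : ℝ} (hx : 0 ≤ x) :
    Integrable (fredIntegrand mu K x) volPos := by
  have hm : 0 < mu ^ 2 + x := by positivity
  refine (integrable_mul_inv_add (memLp_fredWeight_mul mu hK) hm).congr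
    ((ae_restrict_mem measurableSet_Ioi).mono fun t ht => ?_)
  exact (fredIntegrand_eq mu K x ht).symm

theorem symmetrised_eq_of_fredholm {lam mu : ℝ} {K : ℝ → ℂ} {x : ℝ} (hx : 0 < x)
    (h : K x = fredRHS lam mu K x) :
    symmetrised mu K x = ((mu ^ 2 + x : ℝ) : ℂ)⁻¹ -
      lam * (fredWeight mu x * ∫ t, fredIntegrand mu K x t ∂volPos) := by
  have hx0 : (x : ℂ) ≠ 0 := by exact_mod_cast hx.ne'
  have hmx : (mu : ℂ) ^ 2 + x ≠ 0 := by
    have : mu ^ 2 + x ≠ 0 := by positivity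
    exact_mod_cast this
  rw [symmetrised, h, fredRHS, fredWeight]
  push_cast
  field_simp

theorem fredholm_unique {lam mu : ℝ} (hlam : -(1 / Real.pi) < lam) (hmu : 0 < mu) {K L : ℝ → ℂ}
    (hK : MemLp (symmetrised mu K) 2 volPos) (hL : MemLp (symmetrised mu L) 2 volPos)
    (hKe : ∀ᵐ x ∂volPos, K x = fredRHS lam mu K x)
    (hLe : ∀ᵐ x ∂volPos, L x = fredRHS lam mu L x) :
    ∀ᵐ x ∂volPos, K x = L x := by
  have h := eq_zero_of_homogeneous hlam (pow_pos hmu 2) (measurable_fredWeight mu)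
    (fun _ => fredWeight_nonneg mu) (fun _ => fredWeight_le_one mu) (hK.sub hL) ?_
  · filter_upwards [h, ae_restrict_mem measurableSet_Ioi] with x hx hx0
    have hx0' : (0 : ℝ) < x := hx0
    have hne : ((x * (mu ^ 2 + x) : ℝ) : ℂ) ≠ 0 := by
      have : x * (mu ^ 2 + x) ≠ 0 := by positivity
      exact_mod_cast this
    exact (div_left_inj' hne).mp (sub_eq_zero.mp hx)
  · filter_upwards [hKe, hLe, ae_restrict_mem measurableSet_Ioi] with x hxK hxL hx
    have hx0 : (0 : ℝ) < x := hx
    rw [Pi.sub_apply, symmetrised_eq_of_fredholm hx0 hxK, symmetrised_eq_of_fredholm hx0 hxL,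
      sub_sub_sub_cancel_left, ← mul_sub, ← mul_sub,
      ← integral_sub (integrable_fredIntegrand hmu hL hx0.le)
        (integrable_fredIntegrand hmu hK hx0.le), neg_mul, ← mul_neg, ← mul_neg, ← integral_neg]
    congr 2
    refine integral_congr_ae ((ae_restrict_mem measurableSet_Ioi).mono fun t ht => ?_)
    simp only [Pi.sub_apply]
    rw [fredIntegrand_eq mu K x ht, fredIntegrand_eq mu L x ht]
    ring

/-- Under `t = μ² u` and `X = x/μ²` this is the partial fraction `X u/((1+u)(1+u+X)) = (1+X)/(1+u+X)
- 1/(1+u)`, integrated against `φ(u)`. -/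
theorem integral_fredIntegrand_solJ {lam mu : ℝ} (hlam : -(1 / Real.pi) < lam) (hmu : 0 < mu)
    {x : ℝ} (hx : 0 < x) :
    (x : ℂ) * ∫ t, fredIntegrand mu (solJ lam mu) x t ∂volPos =
      (1 + ((x / mu ^ 2 : ℝ) : ℂ)) * phiStieltjes (alphaParam lam) ((x / mu ^ 2 : ℝ) : ℂ) -
        phiStieltjes (alphaParam lam) 0 := by
  have hm : 0 < mu ^ 2 := by positivity
  set X := x / mu ^ 2 with hX
  have hX0 : 0 < X := by positivity
  have hxX : x = mu ^ 2 * X := by rw [hX]; field_simp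
  have ha := neg_half_lt_re_alphaParam hlam
  have ha1 := re_alphaParam_lt_one lam
  have hi1 := integrable_phiStieltjes ha ha1 (z := (X : ℂ)) (by rw [Complex.ofReal_re]; linarith)
  have hi0 := integrable_phiStieltjes ha ha1 (z := 0) (by simp)
  set G : ℝ → ℂ := fun s =>
    (1 + (X : ℂ)) * (gaussPhi (alphaParam lam) (-(s : ℂ)) * (1 + (s : ℂ) + X)⁻¹) -
      gaussPhi (alphaParam lam) (-(s : ℂ)) * (1 + (s : ℂ) + 0)⁻¹ with hG
  have hGi : ∫ s, G s ∂volPos = (1 + (X : ℂ)) * phiStieltjes (alphaParam lam) X -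
      phiStieltjes (alphaParam lam) 0 := by
    rw [hG, integral_sub (hi1.const_mul _) hi0, integral_const_mul]
    rfl
  have hsub : ∫ t, G ((mu ^ 2)⁻¹ * t) ∂volPos = ((mu ^ 2 : ℝ) : ℂ) * ∫ s, G s ∂volPos := by
    have := integral_comp_mul_left_Ioi G 0 (inv_pos.mpr hm)
    rw [mul_zero, inv_inv, Complex.real_smul] at this
    exact this
  rw [← hGi]
  have hmc : ((mu ^ 2 : ℝ) : ℂ) ≠ 0 := by exact_mod_cast hm.ne'
  refine mul_left_cancel₀ hmc ?_
  rw [← hsub, ← integral_const_mul, ← integral_const_mul]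
  refine integral_congr_ae ((ae_restrict_mem measurableSet_Ioi).mono fun t ht => ?_)
  have ht0 : (0 : ℝ) < t := ht
  obtain ⟨u, hu0, rfl⟩ : ∃ u : ℝ, 0 < u ∧ t = mu ^ 2 * u :=
    ⟨t / mu ^ 2, by positivity, by field_simp⟩
  simp only [hG]
  rw [inv_mul_cancel_left₀ hm.ne', fredIntegrand_eq mu _ x ht0, symmetrised_solJ hlam hmu ht0,
    mul_div_cancel_left₀ _ hm.ne', solPhi_eq, fredWeight, hxX]
  have h1 : (1 + (u : ℂ)) ≠ 0 := one_add_ofReal_ne_zero hu0.le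
  have h2 : (1 + (u : ℂ) + X) ≠ 0 :=
    one_add_add_ne_zero (by rw [Complex.ofReal_re]; linarith) hu0.le
  have h3 : ((mu ^ 2 + mu ^ 2 * u : ℝ) : ℂ) = ((mu ^ 2 : ℝ) : ℂ) * (1 + u) := by push_cast; ring
  have h4 : ((mu ^ 2 + mu ^ 2 * X + mu ^ 2 * u : ℝ) : ℂ) = ((mu ^ 2 : ℝ) : ℂ) * (1 + u + X) := by
    push_cast; ring
  rw [Complex.ofReal_div, h3, h4, Complex.ofReal_mul, Complex.ofReal_mul, add_zero]
  field_simp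
  ring

theorem solvesFredholm_solJ {lam mu : ℝ} (hlam : -(1 / Real.pi) < lam) (hmu : 0 < mu) :
    SolvesFredholm lam mu (solJ lam mu) := by
  intro x hx
  refine ⟨integrable_fredIntegrand hmu (memLp_symmetrised_solJ hlam hmu) hx, ?_⟩
  rcases hx.eq_or_lt with rfl | hx0
  · simp [solJ, fredRHS]
  have hX0 : 0 ≤ x / mu ^ 2 := by positivity
  have h1 := solPhi_equation hlam hX0
  have h2 := solPhi_equation hlam le_rfl
  have hne := one_add_ofReal_ne_zero hX0
  rw [solPhi_zero hlam, Complex.ofReal_zero, add_zero, inv_one, mul_one] at h2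
  rw [fredRHS, sq, mul_assoc, mul_assoc, integral_fredIntegrand_solJ hlam hmu hx0, solJ_eq hlam hx,
    Complex.ofReal_mul, Complex.ofReal_add, Complex.ofReal_one]
  have h3 : (1 + ((x / mu ^ 2 : ℝ) : ℂ)) * solPhi lam (x / mu ^ 2) = cParam lam -
      lam * ((1 + ((x / mu ^ 2 : ℝ) : ℂ)) *
        phiStieltjes (alphaParam lam) ((x / mu ^ 2 : ℝ) : ℂ)) := by
    rw [h1]
    field_simp
  -- The equation for `φ` at `0`, namely `1 = c - λ S(0)` with `S` the Stieltjes transform,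
  -- eliminates `c` in favour of the leading term `x`.
  linear_combination (x : ℂ) * h3 - (x : ℂ) * h2

/-! ### The normalisation -/

theorem rescaledRHS_const_mul (lam : ℝ) (a c : ℂ) (f : ℝ → ℂ) (x : ℝ) :
    rescaledRHS lam (a * c) (fun t => a * f t) x = a * rescaledRHS lam c f x := by
  have h : rescaledIntegrand (fun t => a * f t) x = fun t => a * rescaledIntegrand f x t := by
    ext t
    simp only [rescaledIntegrand]
    ring
  rw [rescaledRHS, rescaledRHS, h, integral_const_mul]
  ring

theorem solvesRescaled_unique {lam : ℝ} (hlam : -(1 / Real.pi) < lam) {c : ℂ} {psi : ℝ → ℂ}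
    (hpsi : MemLp psi 2 volPos) (h : SolvesRescaled lam c psi) :
    c = cParam lam ∧ ∀ x : ℝ, 0 ≤ x → psi x = solPhi lam x := by
  -- Uniqueness is available only for a common constant, so `c_λ ψ` and `c φ` are compared: both
  -- solve the equation with constant `c_λ c`.
  have hphi := solvesRescaled_solPhi hlam
  have e1 : ∀ x, 0 ≤ x → cParam lam * psi x =
      rescaledRHS lam (cParam lam * c) (fun t => cParam lam * psi t) x := fun x hx => by
    rw [rescaledRHS_const_mul, ← (h.1 x hx).2]
  have e2 : ∀ x, 0 ≤ x → c * solPhi lam x =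
      rescaledRHS lam (cParam lam * c) (fun t => c * solPhi lam t) x := fun x hx => by
    rw [mul_comm (cParam lam), rescaledRHS_const_mul, ← (hphi.1 x hx).2]
  have hae := rescaled_unique hlam (hpsi.const_mul (cParam lam))
    ((memLp_solPhi hlam).const_mul c)
    ((ae_restrict_mem measurableSet_Ioi).mono fun x hx => e1 x (le_of_lt hx))
    ((ae_restrict_mem measurableSet_Ioi).mono fun x hx => e2 x (le_of_lt hx))
  -- The right-hand side depends on the function only through an integral, so equality almost
  -- everywhere becomes equality at every `x ≥ 0`, in particular at `0`.
  have heq : ∀ x, 0 ≤ x → cParam lam * psi x = c * solPhi lam x := by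
    intro x hx
    rw [e1 x hx, e2 x hx, rescaledRHS, rescaledRHS]
    congr 2
    refine integral_congr_ae (hae.mono fun t ht => ?_)
    simp only [rescaledIntegrand]
    rw [ht]
  have hc : c = cParam lam := by
    have := heq 0 le_rfl
    rwa [h.2, hphi.2, mul_one, mul_one, eq_comm] at this
  refine ⟨hc, fun x hx => mul_left_cancel₀ (cParam_ne_zero hlam) ?_⟩
  rw [heq x hx, hc]

/-- Since `λ` and `c_λ` are real, the conjugate of `φ` solves the same normalised equation, and
uniqueness identifies it with `φ`. -/
theorem solPhi_im {lam : ℝ} (hlam : -(1 / Real.pi) < lam) {x : ℝ} (hx : 0 ≤ x) :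
    (solPhi lam x).im = 0 := by
  have hphi := solvesRescaled_solPhi hlam
  have hc : (starRingEnd ℂ) (cParam lam) = cParam lam := Complex.conj_eq_iff_im.mpr (cParam_im lam)
  have hint : ∀ y, rescaledIntegrand (fun t => (starRingEnd ℂ) (solPhi lam t)) y =
      fun t => (starRingEnd ℂ) (rescaledIntegrand (solPhi lam) y t) := by
    intro y
    ext t
    simp only [rescaledIntegrand, map_div₀, Complex.conj_ofReal]
  have hmem : MemLp (fun t => (starRingEnd ℂ) (solPhi lam t)) 2 volPos :=
    (memLp_solPhi hlam).congr_norm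
      (Complex.continuous_conj.comp_aestronglyMeasurable (memLp_solPhi hlam).1)
      (Filter.Eventually.of_forall fun t => (RCLike.norm_conj _).symm)
  have hsol : SolvesRescaled lam (cParam lam) (fun t => (starRingEnd ℂ) (solPhi lam t)) := by
    refine ⟨fun y hy => ⟨integrable_rescaledIntegrand hmem (by linarith), ?_⟩, ?_⟩
    · simp only [rescaledRHS, hint, integral_conj]
      conv_lhs => rw [(hphi.1 y hy).2]
      simp only [rescaledRHS, map_sub, map_div₀, map_mul, hc, Complex.conj_ofReal]
    · simp only [hphi.2, map_one]
  exact Complex.conj_eq_iff_im.mp ((solvesRescaled_unique hlam hmem hsol).2 x hx)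

theorem solJ_im {lam : ℝ} (hlam : -(1 / Real.pi) < lam) (mu : ℝ) {x : ℝ} (hx : 0 ≤ x) :
    (solJ lam mu x).im = 0 := by
  rw [solJ_eq hlam hx, Complex.im_ofReal_mul, solPhi_im hlam (by positivity), mul_zero]

end SelfDualPhi4

end

theorem mainTheorem1 (lam mu : ℝ) (hlam : -(1 / Real.pi) < lam) (hmu : 0 < mu) :
    -- the parameter
    Complex.sin (SelfDualPhi4.alphaParam lam * (Real.pi : ℂ)) = ((lam * Real.pi : ℝ) : ℂ) ∧
    -- `J` and `φ` are real-valued on the half-line, and so is the constant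
    (∀ x : ℝ, 0 ≤ x → (SelfDualPhi4.solJ lam mu x).im = 0) ∧
    (∀ x : ℝ, 0 ≤ x → (SelfDualPhi4.solPhi lam x).im = 0) ∧
    (SelfDualPhi4.cParam lam).im = 0 ∧
    -- `J` solves the Fredholm equation
    SelfDualPhi4.SolvesFredholm lam mu (SelfDualPhi4.solJ lam mu) ∧
    -- `J` and `φ` correspond to each other under the rescaling
    (∀ x : ℝ, 0 ≤ x → SelfDualPhi4.solJ lam mu x =
      ((x * (1 + x / mu ^ 2) : ℝ) : ℂ) * SelfDualPhi4.solPhi lam (x / mu ^ 2)) ∧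
    -- `φ` solves the rescaled equation with the constant `c_λ`
    SelfDualPhi4.SolvesRescaled lam (SelfDualPhi4.cParam lam) (SelfDualPhi4.solPhi lam) ∧
    -- both solutions lie in the `L²` class
    MeasureTheory.MemLp (SelfDualPhi4.symmetrised mu (SelfDualPhi4.solJ lam mu)) 2
      SelfDualPhi4.volPos ∧
    MeasureTheory.MemLp (SelfDualPhi4.solPhi lam) 2 SelfDualPhi4.volPos ∧
    -- uniqueness for the Fredholm equation
    (∀ K : ℝ → ℂ,
      MeasureTheory.MemLp (SelfDualPhi4.symmetrised mu K) 2 SelfDualPhi4.volPos →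
      (∀ᵐ x ∂SelfDualPhi4.volPos, K x = SelfDualPhi4.fredRHS lam mu K x) →
      ∀ᵐ x ∂SelfDualPhi4.volPos, K x = SelfDualPhi4.solJ lam mu x) ∧
    -- uniqueness for the rescaled equation with the constant `c_λ`
    (∀ psi : ℝ → ℂ, MeasureTheory.MemLp psi 2 SelfDualPhi4.volPos →
      (∀ᵐ x ∂SelfDualPhi4.volPos,
        psi x = SelfDualPhi4.rescaledRHS lam (SelfDualPhi4.cParam lam) psi x) →
      ∀ᵐ x ∂SelfDualPhi4.volPos, psi x = SelfDualPhi4.solPhi lam x) ∧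
    -- the normalisation at `0` determines the constant as well
    (∀ (c : ℂ) (psi : ℝ → ℂ), MeasureTheory.MemLp psi 2 SelfDualPhi4.volPos →
      SelfDualPhi4.SolvesRescaled lam c psi →
      c = SelfDualPhi4.cParam lam ∧ ∀ x : ℝ, 0 ≤ x → psi x = SelfDualPhi4.solPhi lam x) := by
  open SelfDualPhi4 in
  exact ⟨sin_alphaParam hlam, fun x hx => solJ_im hlam mu hx, fun x hx => solPhi_im hlam hx,
    cParam_im lam, solvesFredholm_solJ hlam hmu, fun x hx => solJ_eq hlam hx,
    solvesRescaled_solPhi hlam, memLp_symmetrised_solJ hlam hmu, memLp_solPhi hlam,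
    fun K hK hKe => fredholm_unique hlam hmu hK (memLp_symmetrised_solJ hlam hmu) hKe
      ((MeasureTheory.ae_restrict_mem measurableSet_Ioi).mono
        fun x hx => (solvesFredholm_solJ hlam hmu x (le_of_lt hx)).2),
    fun psi hpsi he => rescaled_unique hlam hpsi (memLp_solPhi hlam) he
      ((MeasureTheory.ae_restrict_mem measurableSet_Ioi).mono
        fun x hx => ((solvesRescaled_solPhi hlam).1 x (le_of_lt hx)).2),
    fun c psi hpsi h => solvesRescaled_unique hlam hpsi h⟩
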